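/- Let $H\in\mathbb F_2^{C\times V}$ be a parity-check matrix with finite sets $C$ of check nodes (CNs) and $V$ of variable nodes (VNs), let its Tanner graph have an edge $vc$ iff $H_{cv}=1$, and let the CNs be partitioned into ordered layers by a map $\mathrm{layer}:C\to\{1,\dots,m_b\}$ (for a QC-LDPC code: the row blocks of $H$). For $\mathcal S\subseteq V$ let $\Gamma(\mathcal S)$ be the set of CNs adjacent to $\mathcal S$, let the induced subgraph $G(\mathcal S)$ be the subgraph of the Tanner graph induced by $\mathcal S\cup\Gamma(\mathcal S)$, and call $c\in\Gamma(\mathcal S)$ missatisfied if it has even degree in $G(\mathcal S)$. $\mathcal S$ is a leafless elementary trapping set (LETS) if every $c\in\Gamma(\mathcal S)$ has degree $1$ or $2$ in $G(\mathcal S)$ and every $v\in\mathcal S$ is adjacent to at least two missatisfied CNs. A connected LETS is a simple cycle if every $v\in\mathcal S$ is adjacent to exactly two missatisfied CNs. The state variables of $\mathcal S$ are the $m_s$ edges $(v,c)$ with $v\in\mathcal S$ and $c$ missatisfied. The flooding transition matrix $\mathbf A\in\{0,1\}^{m_s\times m_s}$ has entry $1$ at row $(v,c)$ and column $(v',c')$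 iff $c'\ne c$, $v'\ne v$ and $v$ is adjacent to $c'$. Let $L_1<\dots<L_J$ be the layers that contain missatisfied CNs of $\mathcal S$. The matrix $\mathcal A_j$ has the rows of $\mathbf A$ at the state variables $(v,c)$ with $\mathrm{layer}(c)=L_j$ and the rows of the identity matrix elsewhere. Put $\tilde{\mathbf A}_{J\to1}=\mathcal A_J\mathcal A_{J-1}\cdots\mathcal A_1$. Let $n_z$ be the number of state variables $x=(v,c)$ such that every state variable $(w,d)$ whose row in $\mathbf A$ has a $1$ in column $x$ satisfies $\mathrm{layer}(d)>\mathrm{layer}(c)$. A Frobenius normal form (FNF) of a square matrix is a symmetric permutation of it to a block upper triangular matrix, each of whose diagonal blocks is either irreducible or a $1\times1$ zero matrix (a $1\times 1$ zero matrix is not counted as irreducible). **Theorem.** Let $\mathcal S$ be a LETS such that $G(\mathcal S)$ is connected and $\mathcal S$ is not a simple cycle. Then $\tilde{\mathbf A}_{J\to1}$ has an FNF, and every FNF of it has exactly one irreducible diagonal block $\tilde{\mathbf A}$. This block is the last one, it has size $m_s-n_z$, and the FNF has the form $$\begin{pmatrix}\mathbf 0_{n_z\times n_z}&\tilde{\mathbf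 A}'\\ \mathbf 0&\tilde{\mathbf A}\end{pmatrix}.$$ Moreover: (a) $\tilde{\mathbf A}_{J\to1}$ has a simple (algebraic multiplicity one) real eigenvalue $\tilde r>1$ equal to its spectral radius. (b) $\tilde{\mathbf A}$ has a left eigenvector $\tilde{\boldsymbol\omega}_1^T$ for $\tilde r$ with positive entries, and in the ordering of the FNF the non-negative vector $\tilde{\mathbf w}_1^T=(\mathbf 0_{1\times n_z}\mid\tilde{\boldsymbol\omega}_1^T)$ is, up to scaling, the unique left eigenvector of $\tilde{\mathbf A}_{J\to1}$ for $\tilde r$. (c) $\tilde{\mathbf A}$ has a right eigenvector $\tilde{\boldsymbol\nu}_1$ for $\tilde r$ with positive entries, and in the ordering of the FNF the non-negative vector $\tilde{\mathbf u}_1=\begin{pmatrix}\tilde r^{-1}\tilde{\mathbf A}'\tilde{\boldsymbol\nu}_1\\ \tilde{\boldsymbol\nu}_1\end{pmatrix}$ is, up to scaling, the unique right eigenvector of $\tilde{\mathbf A}_{J\to1}$ for $\tilde r$. -/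

import Mathlib

namespace LETS

section TannerGraph

variable {C V : Type*} [Fintype C]

/-- The Tanner graph of a binary code with parity-check matrix `H`: the variable nodes are the
columns, the check nodes are the rows, and `v` and `c` are adjacent iff `H c v = 1`. -/
def tannerGraph (H : Matrix C V (ZMod 2)) : SimpleGraph (V ⊕ C) where
  Adj x y := (∃ v c, x = Sum.inl v ∧ y = Sum.inr c ∧ H c v = 1) ∨
    (∃ v c, x = Sum.inr c ∧ y = Sum.inl v ∧ H c v = 1)
  symm := ⟨by
    rintro x y (⟨v, c, hx, hy, h⟩ | ⟨v, c, hx, hy, h⟩)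
    · exact Or.inr ⟨v, c, hy, hx, h⟩
    · exact Or.inl ⟨v, c, hy, hx, h⟩⟩
  loopless := ⟨by
    rintro x (⟨v, c, hx, hy, h⟩ | ⟨v, c, hx, hy, h⟩) <;> simp [hx] at hy⟩

/-- The degree of the check node `c` in the subgraph induced by the set `S` of variable nodes. -/
def checkDegree (H : Matrix C V (ZMod 2)) (S : Finset V) (c : C) : ℕ :=
  (S.filter fun v => H c v = 1).card

/-- `Γ(S)`: the check nodes adjacent to at least one variable node of `S`. -/
def checkNeighbors (H : Matrix C V (ZMod 2)) (S : Finset V) : Finset C :=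
  Finset.univ.filter fun c => 1 ≤ checkDegree H S c

/-- The missatisfied check nodes: the check nodes in `Γ(S)` of even degree in the induced
subgraph. -/
def missatisfied (H : Matrix C V (ZMod 2)) (S : Finset V) : Finset C :=
  (checkNeighbors H S).filter fun c => Even (checkDegree H S c)

/-- The subgraph of the Tanner graph induced by the variable nodes in `S` and the check nodes in
`Γ(S)`. -/
def inducedSubgraph (H : Matrix C V (ZMod 2)) (S : Finset V) :
    SimpleGraph ↥(Sum.inl '' (S : Set V) ∪ Sum.inr '' (checkNeighbors H S : Set C) :
      Set (V ⊕ C)) :=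
  (tannerGraph H).induce _

/-- The number of missatisfied check nodes to which the variable node `v` is connected. -/
def missatisfiedDegree (H : Matrix C V (ZMod 2)) (S : Finset V) (v : V) : ℕ :=
  ((missatisfied H S).filter fun c => H c v = 1).card

/-- `S` is a leafless elementary trapping set: all check nodes in the induced subgraph have degree
`1` or `2`, and each variable node of `S` is connected to at least two missatisfied check nodes. -/
structure IsLETS (H : Matrix C V (ZMod 2)) (S : Finset V) : Prop where
  elementary : ∀ c ∈ checkNeighbors H S, checkDegree H S c = 1 ∨ checkDegree H S c = 2
  leafless : ∀ v ∈ S, 2 ≤ missatisfiedDegree H S v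

/-- `S` is a simple cycle: a connected LETS in which every variable node is connected to exactly
two missatisfied check nodes. -/
structure IsSimpleCycle (H : Matrix C V (ZMod 2)) (S : Finset V) : Prop where
  isLETS : IsLETS H S
  connected : (inducedSubgraph H S).Connected
  degree_eq_two : ∀ v ∈ S, missatisfiedDegree H S v = 2

/-- The state variables: one for each edge `(v, c)` between a variable node `v ∈ S` and a
missatisfied check node `c`, standing for the message sent from `v` to `c`. -/
abbrev StateVar (H : Matrix C V (ZMod 2)) (S : Finset V) : Type _ :=
  {e : V × C // e.1 ∈ S ∧ e.2 ∈ missatisfied H S ∧ H e.2 e.1 = 1}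

end TannerGraph

section Transition

variable {C V : Type*} [Fintype C] [Fintype V] [DecidableEq C] [DecidableEq V]

/-- The transition matrix `A` of the flooding schedule. The message from `v` to `c` is a function
of the messages which `v` receives from its other missatisfied check nodes `c' ≠ c`, that is, of
the messages sent to such `c'` by the other neighbour `v' ≠ v` of `c'` in `S`. -/
def floodingMatrix (H : Matrix C V (ZMod 2)) (S : Finset V) :
    Matrix (StateVar H S) (StateVar H S) ℝ :=
  Matrix.of fun x y =>
    if y.1.2 ≠ x.1.2 ∧ y.1.1 ≠ x.1.1 ∧ H y.1.2 x.1.1 = 1 then 1 else 0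

variable {mb : ℕ}

/-- The transition matrix `𝒜_j` of layer `j`: the rows belonging to the state variables of layer
`j` are those of `A`, and all other rows are those of the identity matrix. -/
def layerMatrix (H : Matrix C V (ZMod 2)) (layer : C → Fin mb) (S : Finset V) (j : Fin mb) :
    Matrix (StateVar H S) (StateVar H S) ℝ :=
  Matrix.of fun x y =>
    if layer x.1.2 = j then floodingMatrix H S x y else (1 : Matrix _ _ ℝ) x y

/-- The set `{L_1, …, L_J}` of the layers containing missatisfied check nodes of `S`. -/
def layersOf (H : Matrix C V (ZMod 2)) (layer : C → Fin mb) (S : Finset V) : Finset (Fin mb) :=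
  (missatisfied H S).image layer

/-- The transition matrix `𝒜_J ⋯ 𝒜_1` of the layered decoder; layers with smaller index are
updated earlier. -/
noncomputable def layeredMatrix (H : Matrix C V (ZMod 2)) (layer : C → Fin mb) (S : Finset V) :
    Matrix (StateVar H S) (StateVar H S) ℝ :=
  (((layersOf H layer S).sort (· ≥ ·)).map (layerMatrix H layer S)).prod

open Classical in
/-- `n_z`: the number of state variables `x` such that all state variables which depend on `x` in
the flooding schedule are updated in strictly later layers than `x`. -/
noncomputable def nz (H : Matrix C V (ZMod 2)) (layer : C → Fin mb) (S : Finset V) : ℕ :=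
  (Finset.univ.filter fun x : StateVar H S =>
    ∀ y, floodingMatrix H S y x ≠ 0 → layer x.1.2 < layer y.1.2).card

end Transition

section NormalForm

variable {ι : Type*}

/-- `b : ι → Fin t` puts `M` into Frobenius normal form: listing the indices in the order of their
block number `b` is a symmetric permutation of `M` into a `t × t` block upper triangular array,
each of whose (nonempty) diagonal blocks is either irreducible or a `1 × 1` zero matrix. -/
structure IsFrobeniusNormalForm (M : Matrix ι ι ℝ) {t : ℕ} (b : ι → Fin t) : Prop where
  surjective : Function.Surjective b
  blockTriangular : M.BlockTriangular b
  diagonal : ∀ k, (M.toSquareBlock b k).IsIrreducible ∨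
    (Nat.card {x // b x = k} = 1 ∧ M.toSquareBlock b k = 0)

/-- The vector on `ι` that equals `ν` on the `k`-th block and `ν'` on its complement. -/
def stack {t : ℕ} (b : ι → Fin t) (k : Fin t) (ν' : {x // b x ≠ k} → ℝ) (ν : {x // b x = k} → ℝ) :
    ι → ℝ :=
  fun x => if h : b x = k then ν ⟨x, h⟩ else ν' ⟨x, h⟩

end NormalForm

end LETS

/-!
Read each state variable `(v, c)` as an arc that leaves `v` through the missatisfied check node
`c`, which has exactly one other neighbour in `S`. The flooding matrix is then the adjacency
relation of non-backtracking walks. The non-backtracking random walk is doubly stochastic, so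
reachability between arcs is symmetric, and at a variable node with three missatisfied check nodes
a walk can be turned around. Hence the flooding matrix of a connected LETS other than a simple
cycle is irreducible.

The layered matrix is a Gauss–Seidel sweep of the flooding matrix. The column of a state variable
vanishes if all updates depending on it happen in later layers, and every state variable reaches
each of the remaining ones. The remaining state variables therefore form the only irreducible
block; nothing else is reachable, so the block comes last, and the zero columns contribute only the
factor `X ^ n_z` to the characteristic polynomial. Perron–Frobenius theory for the block, by way of
the Collatz–Wielandt number, yields the eigenvalue and its eigenvectors. The eigenvalue exceeds one
because all row sums are at least one, and the row sum of some state variable in the block is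
larger: otherwise a row with large sum would be used in a later layer, whose row sum would then be
large as well.
-/

namespace LETS

open Matrix Relation

section Irreducible

theorem isIrreducible_iff_transGen {n R : Type*} [Ring R] [LinearOrder R] {A : Matrix n n R} :
    A.IsIrreducible ↔ (∀ i j, 0 ≤ A i j) ∧ ∀ i j, TransGen (fun i j => 0 < A i j) i j := by
  rw [isIrreducible_iff]
  refine and_congr_right fun _ => forall₂_congr fun i j => ?_
  let : Quiver n := toQuiver A
  constructor
  · rintro ⟨p, hp⟩
    induction p with
    | nil => simp at hp
    | @cons b c q e ih =>
      rcases Nat.eq_zero_or_pos q.length with h0 | h0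
      · obtain rfl := Quiver.Path.eq_of_length_zero q h0
        exact .single e.down
      · exact (ih h0).tail e.down
  · intro h
    induction h with
    | single e => exact ⟨Quiver.Path.nil.cons (PLift.up e), by simp⟩
    | tail _ e ih =>
      obtain ⟨p, _⟩ := ih
      exact ⟨p.cons (PLift.up e), by simp⟩

variable {n R : Type*} [Fintype n] [CommRing R] [LinearOrder R] [IsStrictOrderedRing R]
  {A : Matrix n n R}

theorem exists_commute_pos (hA : A.IsIrreducible) :
    ∃ Q : Matrix n n R, Commute A Q ∧ ∀ i j, 0 < Q i j := by
  classical
  choose k _ hk using (isIrreducible_iff_exists_pow_pos hA.nonneg).1 hA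
  refine ⟨∑ p : n × n, A ^ k p.1 p.2, ?_, fun i j => ?_⟩
  · exact Commute.sum_right _ _ _ fun p _ => (Commute.refl A).pow_right _
  · rw [Matrix.sum_apply]
    exact Finset.sum_pos' (fun p _ => pow_apply_nonneg hA.nonneg _ _ _)
      ⟨(i, j), Finset.mem_univ _, hk i j⟩

theorem mulVec_pos {Q : Matrix n n R} (hQ : ∀ i j, 0 < Q i j) {y : n → R} (hy : 0 ≤ y)
    (hy0 : y ≠ 0) (i : n) : 0 < (Q *ᵥ y) i := by
  obtain ⟨j, hj⟩ := Function.ne_iff.1 hy0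
  exact Finset.sum_pos' (fun k _ => mul_nonneg (hQ i k).le (hy k))
    ⟨j, Finset.mem_univ j, mul_pos (hQ i j) (lt_of_le_of_ne (hy j) (Ne.symm hj))⟩

theorem pos_of_mulVec_le (hA : A.IsIrreducible) {x : n → R} {c : R} (hx : 0 ≤ x) (hx0 : x ≠ 0)
    (hc : A *ᵥ x ≤ c • x) (i : n) : 0 < x i := by
  have hstep : ∀ a b, 0 < A a b → 0 < x b → 0 < x a := fun a b hab hb => by
    refine lt_of_le_of_ne (hx a) fun h0 => ?_
    have hle := hc a
    rw [Pi.smul_apply, ← h0, smul_zero] at hle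
    exact hle.not_gt (Finset.sum_pos' (fun k _ => mul_nonneg (hA.nonneg a k) (hx k))
      ⟨b, Finset.mem_univ b, mul_pos hab hb⟩)
  obtain ⟨j, hj⟩ := Function.ne_iff.1 hx0
  have hj : 0 < x j := lt_of_le_of_ne (hx j) hj.symm
  have hpath := (isIrreducible_iff_transGen.1 hA).2 i j
  induction hpath using TransGen.head_induction_on with
  | single e => exact hstep _ _ e hj
  | head e _ ih => exact hstep _ _ e ih

-- Subtract from `u` the largest multiple of `ν` that leaves it non-negative: the rest vanishes
-- somewhere, so by `pos_of_mulVec_le` it is zero.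
theorem eq_smul_of_mulVec_eq {𝕜 : Type*} [Field 𝕜] [LinearOrder 𝕜] [IsStrictOrderedRing 𝕜]
    [Nonempty n] {A : Matrix n n 𝕜} (hA : A.IsIrreducible) {ν u : n → 𝕜} {r : 𝕜}
    (hν : ∀ i, 0 < ν i) (hAν : A *ᵥ ν = r • ν) (hu : A *ᵥ u = r • u) : ∃ s : 𝕜, u = s • ν := by
  obtain ⟨i₀, hi₀⟩ := Finite.exists_min fun i => u i / ν i
  set s := u i₀ / ν i₀
  refine ⟨s, ?_⟩
  by_contra hne
  have hrest : 0 ≤ u - s • ν := fun i => by simpa using (le_div_iff₀ (hν i)).1 (hi₀ i)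
  have hA_rest : A *ᵥ (u - s • ν) = r • (u - s • ν) := by
    rw [mulVec_sub, mulVec_smul, hAν, hu, smul_sub, smul_comm]
  have hpos := pos_of_mulVec_le hA hrest (sub_ne_zero.2 hne) hA_rest.le i₀
  simp [s, (hν i₀).ne'] at hpos

end Irreducible

section PerronVector

variable {n : Type*} [Fintype n] {A : Matrix n n ℝ}

/-- The pairs `(x, ρ)` of a probability vector `x` and a number `ρ ≥ 0` with `ρ x ≤ A x`. The
largest such `ρ` is the Collatz–Wielandt number of `A`. -/
def subeigenpairs (A : Matrix n n ℝ) : Set ((n → ℝ) × ℝ) :=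
  {p | p.1 ∈ stdSimplex ℝ n ∧ 0 ≤ p.2 ∧ p.2 • p.1 ≤ A *ᵥ p.1}

theorem snd_le_sum_of_mem_subeigenpairs (hA : ∀ i j, 0 ≤ A i j) {p : (n → ℝ) × ℝ}
    (hp : p ∈ subeigenpairs A) : p.2 ≤ ∑ i, ∑ j, A i j := by
  obtain ⟨⟨hx, hsum⟩, -, hle⟩ := hp
  have hx_le_one : ∀ j, p.1 j ≤ 1 := fun j =>
    hsum ▸ Finset.single_le_sum (fun k _ => hx k) (Finset.mem_univ j)
  calc p.2 = ∑ i, (p.2 • p.1) i := by simp [← Finset.mul_sum, hsum]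
    _ ≤ ∑ i, (A *ᵥ p.1) i := Finset.sum_le_sum fun i _ => hle i
    _ ≤ ∑ i, ∑ j, A i j := Finset.sum_le_sum fun i _ => Finset.sum_le_sum fun j _ =>
      mul_le_of_le_one_right (hA i j) (hx_le_one j)

theorem isCompact_subeigenpairs (hA : ∀ i j, 0 ≤ A i j) : IsCompact (subeigenpairs A) := by
  have hclosed : IsClosed {p : (n → ℝ) × ℝ | p.2 • p.1 ≤ A *ᵥ p.1} := by
    refine isClosed_le (by fun_prop) (continuous_pi fun i => ?_)
    simp only [mulVec, dotProduct]
    fun_prop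
  refine (((isCompact_stdSimplex ℝ n).prod isCompact_Icc).inter_right hclosed).of_isClosed_subset
    ?_ fun p hp => ⟨⟨hp.1, hp.2.1, snd_le_sum_of_mem_subeigenpairs hA hp⟩, hp.2.2⟩
  exact ((isClosed_stdSimplex ℝ n).preimage continuous_fst).inter
    ((isClosed_Ici.preimage continuous_snd).inter hclosed)

theorem subeigenpairs_nonempty [Nonempty n] (hA : ∀ i j, 0 ≤ A i j) :
    (subeigenpairs A).Nonempty := by
  classical
  obtain ⟨i⟩ := ‹Nonempty n›
  refine ⟨(Pi.single i 1, 0), single_mem_stdSimplex ℝ i, le_rfl, fun j => ?_⟩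
  simpa using hA j i

theorem exists_mem_subeigenpairs_lt [Nonempty n] {x : n → ℝ} {ρ : ℝ} (hx : ∀ i, 0 < x i)
    (hρ : 0 ≤ ρ) (hlt : ∀ i, ρ * x i < (A *ᵥ x) i) : ∃ q ∈ subeigenpairs A, ρ < q.2 := by
  obtain ⟨i₀, hi₀⟩ := Finite.exists_min fun i => (A *ᵥ x) i / x i
  set ρ' := (A *ᵥ x) i₀ / x i₀
  have hρ' : ρ < ρ' := (lt_div_iff₀ (hx i₀)).2 (hlt i₀)
  have hle : ρ' • x ≤ A *ᵥ x := fun i => (le_div_iff₀ (hx i)).1 (hi₀ i)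
  have hsum : 0 < ∑ i, x i := Finset.sum_pos (fun i _ => hx i) Finset.univ_nonempty
  refine ⟨((∑ i, x i)⁻¹ • x, ρ'), ⟨⟨fun i => ?_, ?_⟩, hρ.trans hρ'.le, ?_⟩, hρ'⟩
  · exact mul_nonneg (inv_nonneg.2 hsum.le) (hx i).le
  · simp only [Pi.smul_apply, smul_eq_mul, ← Finset.mul_sum]
    exact inv_mul_cancel₀ hsum.ne'
  · rw [mulVec_smul, smul_comm]
    exact smul_le_smul_of_nonneg_left hle (inv_nonneg.2 hsum.le)

-- A positive matrix commuting with `A` turns the non-zero vector `A x - ρ x ≥ 0` into a positive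
-- one.
theorem exists_mem_subeigenpairs_lt_of_ne [Nonempty n] (hA : A.IsIrreducible)
    {p : (n → ℝ) × ℝ} (hp : p ∈ subeigenpairs A) (hne : A *ᵥ p.1 ≠ p.2 • p.1) :
    ∃ q ∈ subeigenpairs A, p.2 < q.2 := by
  obtain ⟨⟨hx, hsum⟩, hρ, hle⟩ := hp
  obtain ⟨Q, hAQ, hQ⟩ := exists_commute_pos hA
  have hx0 : p.1 ≠ 0 := fun h => by simp [h] at hsum
  refine exists_mem_subeigenpairs_lt (x := Q *ᵥ p.1) (mulVec_pos hQ hx hx0) hρ fun i => ?_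
  have hpos := mulVec_pos hQ (sub_nonneg.2 hle) (sub_ne_zero.2 hne) i
  rw [mulVec_sub, mulVec_smul, mulVec_mulVec, ← hAQ.eq, ← mulVec_mulVec] at hpos
  simpa using hpos

theorem exists_pos_mulVec_eq [Nonempty n] (hA : A.IsIrreducible) :
    ∃ (r : ℝ) (ν : n → ℝ), (∀ i, 0 < ν i) ∧ A *ᵥ ν = r • ν := by
  obtain ⟨p, hp, hmax⟩ := (isCompact_subeigenpairs hA.nonneg).exists_isMaxOn
    (subeigenpairs_nonempty hA.nonneg) continuous_snd.continuousOn
  have heq : A *ᵥ p.1 = p.2 • p.1 := by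
    by_contra hne
    obtain ⟨q, hq, hlt⟩ := exists_mem_subeigenpairs_lt_of_ne hA hp hne
    exact (hmax hq).not_gt hlt
  have hp0 : p.1 ≠ 0 := fun h => by simpa [h] using hp.1.2
  exact ⟨p.2, p.1, pos_of_mulVec_le hA hp.1.1 hp0 heq.le, heq⟩

end PerronVector

section PerronRoot

variable {n : Type*} [Fintype n] [DecidableEq n]

theorem maxGenEigenspace_toLin'_eq_span {K : Type*} [Field K] {A : Matrix n n K} {r : K}
    {u w : n → K} (hu : A *ᵥ u = r • u) (hw : w ᵥ* A = r • w) (hwu : w ⬝ᵥ u ≠ 0)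
    (huniq : ∀ v, A *ᵥ v = r • v → ∃ s : K, v = s • u) :
    Module.End.maxGenEigenspace A.toLin' r = Submodule.span K {u} := by
  have happly : ∀ v, (A.toLin' - r • (1 : Module.End K (n → K))) v = A *ᵥ v - r • v := by simp
  refine le_antisymm (fun v hv => ?_) ?_
  · obtain ⟨k, hk⟩ := (Module.End.mem_maxGenEigenspace _ _ _).1 hv
    clear hv
    rw [Submodule.mem_span_singleton]
    induction k generalizing v with
    | zero => exact ⟨0, by simpa using hk.symm⟩
    | succ k ih =>
      rw [pow_succ, Module.End.mul_apply] at hk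
      obtain ⟨s, hs⟩ := ih _ hk
      rw [happly] at hs
      -- `w` annihilates the range of `A - r`, but not `u`
      have hw_range : w ⬝ᵥ (A *ᵥ v - r • v) = 0 := by
        rw [dotProduct_sub, dotProduct_mulVec, hw, smul_dotProduct, dotProduct_smul, sub_self]
      rw [← hs, dotProduct_smul, smul_eq_mul] at hw_range
      rw [(mul_eq_zero.1 hw_range).resolve_right hwu, zero_smul] at hs
      obtain ⟨t, rfl⟩ := huniq v (sub_eq_zero.1 hs.symm)
      exact ⟨t, rfl⟩
  · rw [Submodule.span_singleton_le_iff_mem, Module.End.mem_maxGenEigenspace]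
    exact ⟨1, by rw [pow_one, happly, hu, sub_self]⟩

theorem rootMultiplicity_charpoly_eq_one {K : Type*} [Field K] {A : Matrix n n K} {r : K}
    {u w : n → K} (hu : A *ᵥ u = r • u) (hw : w ᵥ* A = r • w) (hwu : w ⬝ᵥ u ≠ 0)
    (huniq : ∀ v, A *ᵥ v = r • v → ∃ s : K, v = s • u) :
    A.charpoly.rootMultiplicity r = 1 := by
  have hu0 : u ≠ 0 := by
    rintro rfl
    simp at hwu
  rw [← charpoly_toLin' A, ← LinearMap.finrank_maxGenEigenspace_eq,
    maxGenEigenspace_toLin'_eq_span hu hw hwu huniq, finrank_span_singleton hu0]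

variable {A : Matrix n n ℝ} {r : ℝ} {ω : n → ℝ}

theorem norm_le_of_mem_spectrum (hA : ∀ i j, 0 ≤ A i j) (hω : ∀ i, 0 < ω i)
    (hωA : ω ᵥ* A = r • ω) {μ : ℂ} (hμ : μ ∈ spectrum ℂ (A.map (algebraMap ℝ ℂ))) : ‖μ‖ ≤ r := by
  rw [← spectrum_toLin', ← Module.End.hasEigenvalue_iff_mem_spectrum] at hμ
  obtain ⟨z, hz⟩ := hμ.exists_hasEigenvector
  have hAz : A.map (algebraMap ℝ ℂ) *ᵥ z = μ • z := by simpa using hz.apply_eq_smul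
  have hle : ∀ i, ‖μ‖ * ‖z i‖ ≤ (A *ᵥ fun j => ‖z j‖) i := fun i =>
    calc ‖μ‖ * ‖z i‖ = ‖(A.map (algebraMap ℝ ℂ) *ᵥ z) i‖ := by
          rw [hAz, Pi.smul_apply, smul_eq_mul, norm_mul]
      _ ≤ ∑ j, ‖algebraMap ℝ ℂ (A i j) * z j‖ := norm_sum_le _ _
      _ = ∑ j, A i j * ‖z j‖ := Finset.sum_congr rfl fun j _ => by
        rw [norm_mul, norm_algebraMap', Real.norm_of_nonneg (hA i j)]
  have hpos : 0 < ∑ i, ω i * ‖z i‖ := by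
    obtain ⟨i, hi⟩ := Function.ne_iff.1 hz.2
    exact Finset.sum_pos' (fun j _ => mul_nonneg (hω j).le (norm_nonneg _))
      ⟨i, Finset.mem_univ i, mul_pos (hω i) (norm_pos_iff.2 hi)⟩
  refine le_of_mul_le_mul_right ?_ hpos
  calc ‖μ‖ * ∑ i, ω i * ‖z i‖ = ∑ i, ω i * (‖μ‖ * ‖z i‖) := by
        simp only [Finset.mul_sum, mul_left_comm]
    _ ≤ ω ⬝ᵥ (A *ᵥ fun j => ‖z j‖) :=
        Finset.sum_le_sum fun i _ => mul_le_mul_of_nonneg_left (hle i) (hω i).le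
    _ = r * ∑ i, ω i * ‖z i‖ := by
        rw [dotProduct_mulVec, hωA, smul_dotProduct, smul_eq_mul, dotProduct]

theorem mem_spectrum_of_vecMul_eq {K : Type*} [Field K] {A : Matrix n n K} {r : K} {w : n → K}
    (hw0 : w ≠ 0) (hw : w ᵥ* A = r • w) : r ∈ spectrum K A := by
  rw [mem_spectrum_iff_isRoot_charpoly, ← charpoly_transpose, ← mem_spectrum_iff_isRoot_charpoly,
    ← spectrum_toLin', ← Module.End.hasEigenvalue_iff_mem_spectrum]
  exact Module.End.hasEigenvalue_of_hasEigenvector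
    ⟨Module.End.mem_eigenspace_iff.2 (by rw [toLin'_apply, mulVec_transpose, hw]), hw0⟩

theorem spectralRadius_eq_of_pos_vecMul [Nonempty n] (hA : ∀ i j, 0 ≤ A i j)
    (hω : ∀ i, 0 < ω i) (hωA : ω ᵥ* A = r • ω) :
    spectralRadius ℂ (A.map (algebraMap ℝ ℂ)) = ENNReal.ofReal r := by
  have hω0 : ω ≠ 0 := by
    rintro rfl
    exact lt_irrefl _ (hω (Classical.arbitrary n))
  have hr : (r : ℂ) ∈ spectrum ℂ (A.map (algebraMap ℝ ℂ)) := by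
    rw [mem_spectrum_iff_isRoot_charpoly, charpoly_map]
    exact (mem_spectrum_iff_isRoot_charpoly.1 (mem_spectrum_of_vecMul_eq hω0 hωA)).map
  refine le_antisymm (iSup₂_le fun μ hμ => ?_) (le_trans (le_of_eq ?_) (le_iSup₂ (r : ℂ) hr))
  · rw [← ENNReal.ofReal_coe_nnreal, coe_nnnorm]
    exact ENNReal.ofReal_le_ofReal (norm_le_of_mem_spectrum hA hω hωA hμ)
  · have hr0 := (norm_nonneg _).trans (norm_le_of_mem_spectrum hA hω hωA hr)
    rw [← ENNReal.ofReal_coe_nnreal, coe_nnnorm, Complex.norm_real, Real.norm_of_nonneg hr0]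

/-- The spectral radius of a real matrix as a real number, which is the Perron root if the matrix
is irreducible. Complex eigenvalues are taken into account. -/
noncomputable def perronRoot (A : Matrix n n ℝ) : ℝ :=
  (spectralRadius ℂ (A.map (algebraMap ℝ ℂ))).toReal

theorem perronRoot_eq_of_pos_vecMul [Nonempty n] (hA : ∀ i j, 0 ≤ A i j) (hω : ∀ i, 0 < ω i)
    (hωA : ω ᵥ* A = r • ω) : perronRoot A = r := by
  obtain ⟨i⟩ := ‹Nonempty n›
  have hr : 0 ≤ r * ω i := by
    rw [← smul_eq_mul, ← Pi.smul_apply, ← hωA]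
    exact Finset.sum_nonneg fun j _ => mul_nonneg (hω j).le (hA j i)
  rw [perronRoot, spectralRadius_eq_of_pos_vecMul hA hω hωA,
    ENNReal.toReal_ofReal (nonneg_of_mul_nonneg_left hr (hω i))]

variable [Nonempty n]

theorem exists_pos_vecMul_eq_perronRoot (hA : A.IsIrreducible) :
    ∃ ω : n → ℝ, (∀ i, 0 < ω i) ∧ ω ᵥ* A = perronRoot A • ω := by
  obtain ⟨r, ω, hω, hωA⟩ := exists_pos_mulVec_eq hA.transpose
  rw [mulVec_transpose] at hωA
  exact ⟨ω, hω, by rw [perronRoot_eq_of_pos_vecMul hA.nonneg hω hωA, hωA]⟩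

theorem exists_pos_mulVec_eq_perronRoot (hA : A.IsIrreducible) :
    ∃ ν : n → ℝ, (∀ i, 0 < ν i) ∧ A *ᵥ ν = perronRoot A • ν := by
  obtain ⟨r, ν, hν, hAν⟩ := exists_pos_mulVec_eq hA
  obtain ⟨ω, hω, hωA⟩ := exists_pos_vecMul_eq_perronRoot hA
  have hpos : 0 < ω ⬝ᵥ ν :=
    Finset.sum_pos (fun i _ => mul_pos (hω i) (hν i)) Finset.univ_nonempty
  have heq := dotProduct_mulVec ω A ν
  rw [hAν, hωA, dotProduct_smul, smul_dotProduct] at heq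
  exact ⟨ν, hν, by rw [hAν, mul_right_cancel₀ hpos.ne' heq]⟩

theorem spectralRadius_eq_ofReal_perronRoot (hA : A.IsIrreducible) :
    spectralRadius ℂ (A.map (algebraMap ℝ ℂ)) = ENNReal.ofReal (perronRoot A) := by
  obtain ⟨ω, hω, hωA⟩ := exists_pos_vecMul_eq_perronRoot hA
  exact spectralRadius_eq_of_pos_vecMul hA.nonneg hω hωA

theorem rootMultiplicity_charpoly_perronRoot (hA : A.IsIrreducible) :
    A.charpoly.rootMultiplicity (perronRoot A) = 1 := by
  obtain ⟨ω, hω, hωA⟩ := exists_pos_vecMul_eq_perronRoot hA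
  obtain ⟨ν, hν, hAν⟩ := exists_pos_mulVec_eq_perronRoot hA
  exact rootMultiplicity_charpoly_eq_one hAν hωA
    (Finset.sum_pos (fun i _ => mul_pos (hω i) (hν i)) Finset.univ_nonempty).ne'
    fun v hv => eq_smul_of_mulVec_eq hA hν hAν hv

theorem perronRoot_pos (hA : A.IsIrreducible) : 0 < perronRoot A := by
  obtain ⟨ω, hω, hωA⟩ := exists_pos_vecMul_eq_perronRoot hA
  obtain ⟨j⟩ := ‹Nonempty n›
  obtain ⟨i, -, hij⟩ := TransGen.tail'_iff.1 ((isIrreducible_iff_transGen.1 hA).2 j j)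
  have hpos : 0 < (ω ᵥ* A) j := Finset.sum_pos'
    (fun k _ => mul_nonneg (hω k).le (hA.nonneg k j)) ⟨i, Finset.mem_univ i, mul_pos (hω i) hij⟩
  rw [hωA] at hpos
  exact pos_of_mul_pos_left hpos (hω j).le

theorem one_lt_perronRoot (hA : A.IsIrreducible) (hrow : ∀ i, 1 ≤ ∑ j, A i j) {i₀ : n}
    (hi₀ : 1 < ∑ j, A i₀ j) : 1 < perronRoot A := by
  obtain ⟨ω, hω, hωA⟩ := exists_pos_vecMul_eq_perronRoot hA
  have hsum : 0 < ∑ i, ω i := Finset.sum_pos (fun i _ => hω i) Finset.univ_nonempty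
  refine lt_of_mul_lt_mul_right ?_ hsum.le
  calc 1 * ∑ i, ω i = ∑ i, ω i * 1 := by rw [one_mul]; simp only [mul_one]
    _ < ∑ i, ω i * ∑ j, A i j :=
        Finset.sum_lt_sum (fun i _ => mul_le_mul_of_nonneg_left (hrow i) (hω i).le)
          ⟨i₀, Finset.mem_univ i₀, mul_lt_mul_of_pos_left hi₀ (hω i₀)⟩
    _ = ∑ j, (ω ᵥ* A) j := by
        simp only [Finset.mul_sum, vecMul, dotProduct]
        exact Finset.sum_comm
    _ = perronRoot A * ∑ i, ω i := by rw [hωA, Finset.mul_sum]; rfl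

end PerronRoot

section ZeroColumns

open Polynomial

theorem charpoly_eq_of_forall_apply_eq_zero {n R : Type*} [Fintype n] [DecidableEq n] [CommRing R]
    {M : Matrix n n R} {p : n → Prop} [DecidablePred p] (hM : ∀ x y, ¬ p y → M x y = 0) :
    M.charpoly = (M.toSquareBlockProp p).charpoly * X ^ Fintype.card {x // ¬ p x} := by
  have hzero : M.toSquareBlockProp (¬ p ·) = 0 := by
    ext x y
    exact hM x y y.2
  have hblock (q : n → Prop) [DecidablePred q] :
      M.charmatrix.toSquareBlockProp q = (M.toSquareBlockProp q).charmatrix := by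
    ext x y : 2
    rcases eq_or_ne x y with rfl | hxy
    · simp [toSquareBlockProp_def]
    · simp [toSquareBlockProp_def, charmatrix_apply_ne _ _ _ hxy,
        charmatrix_apply_ne _ _ _ (Subtype.coe_injective.ne hxy)]
  rw [charpoly, twoBlockTriangular_det' _ p, hblock, hblock, hzero, ← charpoly, ← charpoly,
    charpoly_zero]
  intro x hx y hy
  rw [charmatrix_apply_ne _ _ _ (ne_of_apply_ne p (by simp [hx, hy])), hM x y hy, C_0, neg_zero]

theorem rootMultiplicity_charpoly_toSquareBlockProp {n R : Type*} [Fintype n] [DecidableEq n]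
    [CommRing R] [IsDomain R] {M : Matrix n n R} {p : n → Prop} [DecidablePred p]
    (hM : ∀ x y, ¬ p y → M x y = 0) {r : R} (hr : r ≠ 0) :
    M.charpoly.rootMultiplicity r = (M.toSquareBlockProp p).charpoly.rootMultiplicity r := by
  have hne := M.charpoly_monic.ne_zero
  rw [charpoly_eq_of_forall_apply_eq_zero hM] at hne ⊢
  rw [rootMultiplicity_mul hne, add_eq_left]
  exact rootMultiplicity_eq_zero (by simpa using fun h => (hr h).elim)

theorem spectralRadius_toSquareBlockProp {n : Type*} [Fintype n] [DecidableEq n]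
    {M : Matrix n n ℂ} {p : n → Prop} [DecidablePred p] (hM : ∀ x y, ¬ p y → M x y = 0) :
    spectralRadius ℂ M = spectralRadius ℂ (M.toSquareBlockProp p) := by
  have hmem : ∀ μ, μ ∈ spectrum ℂ M ↔
      μ ∈ spectrum ℂ (M.toSquareBlockProp p) ∨ (X ^ Fintype.card {x // ¬ p x} : ℂ[X]).IsRoot μ := by
    simp only [mem_spectrum_iff_isRoot_charpoly, charpoly_eq_of_forall_apply_eq_zero hM, root_mul,
      implies_true]
  refine le_antisymm (iSup₂_le fun μ hμ => ?_) (iSup₂_le fun μ hμ => ?_)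
  · rcases (hmem μ).1 hμ with hμ | hμ
    · exact le_iSup₂ (α := ENNReal) μ hμ
    · rw [IsRoot, eval_pow, eval_X] at hμ
      simp [eq_zero_of_pow_eq_zero hμ]
  · exact le_iSup₂ (α := ENNReal) μ ((hmem μ).2 (.inl hμ))

end ZeroColumns

section Stack

variable {ι : Type*} {t : ℕ} {b : ι → Fin t} {k : Fin t}

theorem stack_restrict (u : ι → ℝ) : stack b k (fun x => u x) (fun x => u x) = u := by
  funext x
  by_cases hx : b x = k
  · exact dif_pos hx
  · exact dif_neg hx

theorem stack_inj {ν' μ' : {x // b x ≠ k} → ℝ} {ν μ : {x // b x = k} → ℝ} :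
    stack b k ν' ν = stack b k μ' μ ↔ ν' = μ' ∧ ν = μ := by
  refine ⟨fun h => ⟨funext fun x => ?_, funext fun x => ?_⟩, fun h => by rw [h.1, h.2]⟩
  · simpa [stack, x.2] using congrFun h x
  · simpa [stack, x.2] using congrFun h x

theorem smul_stack (r : ℝ) (ν' : {x // b x ≠ k} → ℝ) (ν : {x // b x = k} → ℝ) :
    r • stack b k ν' ν = stack b k (r • ν') (r • ν) := by
  funext x
  by_cases hx : b x = k <;> simp [stack, hx]

theorem stack_nonneg {ν' : {x // b x ≠ k} → ℝ} {ν : {x // b x = k} → ℝ} (hν' : 0 ≤ ν')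
    (hν : 0 ≤ ν) (x : ι) : 0 ≤ stack b k ν' ν x := by
  unfold stack
  split_ifs
  · exact hν _
  · exact hν' _

variable [Fintype ι]

theorem dotProduct_stack (v : ι → ℝ) (ν' : {x // b x ≠ k} → ℝ) (ν : {x // b x = k} → ℝ) :
    v ⬝ᵥ stack b k ν' ν =
      (fun x : {x // b x = k} => v x) ⬝ᵥ ν + (fun x : {x // b x ≠ k} => v x) ⬝ᵥ ν' := by
  simp only [dotProduct]
  rw [← Fintype.sum_subtype_add_sum_subtype (fun x => b x = k)]
  congr 1 <;> refine Finset.sum_congr rfl fun x _ => ?_ <;> simp [stack, x.2]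

variable {M : Matrix ι ι ℝ}

theorem mulVec_stack (hM : ∀ x y, b y ≠ k → M x y = 0) (ν' : {x // b x ≠ k} → ℝ)
    (ν : {x // b x = k} → ℝ) :
    M *ᵥ stack b k ν' ν =
      stack b k (M.toBlock (fun x => b x ≠ k) (fun x => b x = k) *ᵥ ν)
        (M.toSquareBlock b k *ᵥ ν) := by
  funext x
  have hrow : (fun y : {y // b y ≠ k} => M x y) = 0 := funext fun y => hM x y y.2
  rw [mulVec, dotProduct_stack, hrow, zero_dotProduct, add_zero]
  by_cases hx : b x = k <;> simp [stack, hx, mulVec, toBlock, toSquareBlock_def]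

theorem stack_zero_vecMul (hM : ∀ x y, b y ≠ k → M x y = 0) (ω : {x // b x = k} → ℝ) :
    stack b k 0 ω ᵥ* M = stack b k 0 (ω ᵥ* M.toSquareBlock b k) := by
  funext y
  rw [vecMul, dotProduct_comm, dotProduct_stack, dotProduct_zero, add_zero, dotProduct_comm]
  by_cases hy : b y = k
  · simp [stack, hy, vecMul, toSquareBlock_def]
  · simp [stack, hy, hM _ y hy]

variable {r : ℝ}

theorem mulVec_eq_smul_iff (hM : ∀ x y, b y ≠ k → M x y = 0) (hr : r ≠ 0) {u : ι → ℝ} :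
    M *ᵥ u = r • u ↔ ∃ ν, M.toSquareBlock b k *ᵥ ν = r • ν ∧
      u = stack b k (r⁻¹ • M.toBlock (fun x => b x ≠ k) (fun x => b x = k) *ᵥ ν) ν := by
  constructor
  · intro hu
    rw [← stack_restrict (b := b) (k := k) u, mulVec_stack hM, smul_stack, stack_inj] at hu
    refine ⟨_, hu.2, ?_⟩
    rw [hu.1, inv_smul_smul₀ hr, stack_restrict]
  · rintro ⟨ν, hν, rfl⟩
    rw [mulVec_stack hM, smul_stack, smul_inv_smul₀ hr, hν]

theorem vecMul_eq_smul_iff (hM : ∀ x y, b y ≠ k → M x y = 0) (hr : r ≠ 0) {w : ι → ℝ} :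
    w ᵥ* M = r • w ↔ ∃ ω, ω ᵥ* M.toSquareBlock b k = r • ω ∧ w = stack b k 0 ω := by
  constructor
  · intro hw
    have hw0 : (fun x : {x // b x ≠ k} => w x) = 0 := funext fun y => by
      have hy := congrFun hw y
      rw [vecMul, dotProduct, Finset.sum_eq_zero fun x _ => by rw [hM x y y.2, mul_zero]] at hy
      exact (smul_eq_zero.1 hy.symm).resolve_left hr
    rw [← stack_restrict (b := b) (k := k) w, hw0, stack_zero_vecMul hM, smul_stack,
      stack_inj] at hw
    exact ⟨_, hw.2, by rw [← hw0, stack_restrict]⟩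
  · rintro ⟨ω, hω, rfl⟩
    rw [stack_zero_vecMul hM, smul_stack, smul_zero, hω]

end Stack

section FinalClass

variable {ι : Type*}

/-- `p` is a final class of the non-negative matrix `M`: every index reaches all indices of `p`
along the nonzero entries of `M`, and no index reaches any other index. -/
structure IsFinalClass {R : Type*} [Zero R] [Preorder R] (M : Matrix ι ι R) (p : ι → Prop) :
    Prop where
  nonneg : ∀ x y, 0 ≤ M x y
  exists_mem : ∃ y, p y
  apply_eq_zero : ∀ x y, ¬ p y → M x y = 0
  transGen : ∀ x y, p y → TransGen (fun i j => 0 < M i j) x y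

namespace IsFinalClass

theorem isIrreducible {R : Type*} [Ring R] [LinearOrder R] {M : Matrix ι ι R} {p : ι → Prop}
    (hM : IsFinalClass M p) : (M.toSquareBlockProp p).IsIrreducible := by
  refine isIrreducible_iff_transGen.2 ⟨fun x y => hM.nonneg x y, fun x y => ?_⟩
  have hp : ∀ i j, 0 < M i j → p j := fun i j hij => not_imp_comm.1 (hM.apply_eq_zero i j) hij.ne'
  have hpath : ∀ z (hz : p z), TransGen (fun i j => 0 < M i j) x z →
      TransGen (fun i j => 0 < M.toSquareBlockProp p i j) x ⟨z, hz⟩ := fun z hz hxz => by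
    induction hxz with
    | single h => exact .single h
    | @tail a _ hxa h ih =>
      obtain ⟨w, _, hw⟩ := TransGen.tail'_iff.1 hxa
      exact (ih (hp _ _ hw)).tail h
  exact hpath y y.2 (hM.transGen x y y.2)

variable {M : Matrix ι ι ℝ} {p : ι → Prop}

theorem nonempty_subtype (hM : IsFinalClass M p) : Nonempty {x // p x} :=
  let ⟨y, hy⟩ := hM.exists_mem
  ⟨⟨y, hy⟩⟩

variable [Fintype ι] [DecidableEq ι]

theorem spectralRadius_eq_toSquareBlockProp [DecidablePred p] (hM : IsFinalClass M p) :
    spectralRadius ℂ (M.map (algebraMap ℝ ℂ)) =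
      ENNReal.ofReal (perronRoot (M.toSquareBlockProp p)) := by
  have := hM.nonempty_subtype
  rw [spectralRadius_toSquareBlockProp (p := p) fun x y hy => by simp [hM.apply_eq_zero x y hy],
    ← LETS.spectralRadius_eq_ofReal_perronRoot hM.isIrreducible]
  rfl

theorem perronRoot_eq [DecidablePred p] (hM : IsFinalClass M p) :
    perronRoot M = perronRoot (M.toSquareBlockProp p) := by
  rw [perronRoot, hM.spectralRadius_eq_toSquareBlockProp]
  exact ENNReal.toReal_ofReal ENNReal.toReal_nonneg

theorem spectralRadius_eq_ofReal_perronRoot (hM : IsFinalClass M p) :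
    spectralRadius ℂ (M.map (algebraMap ℝ ℂ)) = ENNReal.ofReal (perronRoot M) := by
  classical
  rw [hM.perronRoot_eq, hM.spectralRadius_eq_toSquareBlockProp]

theorem perronRoot_pos (hM : IsFinalClass M p) : 0 < perronRoot M := by
  classical
  have := hM.nonempty_subtype
  rw [hM.perronRoot_eq]
  exact LETS.perronRoot_pos hM.isIrreducible

theorem one_lt_perronRoot (hM : IsFinalClass M p) (hrow : ∀ x, 1 ≤ ∑ y, M x y)
    (hlarge : ∃ x, p x ∧ 1 < ∑ y, M x y) : 1 < perronRoot M := by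
  classical
  have := hM.nonempty_subtype
  have hsum : ∀ x : {x // p x}, ∑ y, M.toSquareBlockProp p x y = ∑ y, M x y := fun x => by
    rw [← Fintype.sum_subtype_add_sum_subtype p (M x),
      Finset.sum_eq_zero (s := (Finset.univ : Finset {y // ¬ p y})) fun y _ =>
        hM.apply_eq_zero x y y.2, add_zero]
    rfl
  obtain ⟨x, hx, hlt⟩ := hlarge
  rw [hM.perronRoot_eq]
  exact LETS.one_lt_perronRoot hM.isIrreducible (fun x => (hsum x).symm ▸ hrow x) (i₀ := ⟨x, hx⟩)
    ((hsum _).symm ▸ hlt)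

theorem rootMultiplicity_charpoly_perronRoot (hM : IsFinalClass M p) :
    M.charpoly.rootMultiplicity (perronRoot M) = 1 := by
  classical
  have := hM.nonempty_subtype
  rw [rootMultiplicity_charpoly_toSquareBlockProp hM.apply_eq_zero hM.perronRoot_pos.ne',
    hM.perronRoot_eq]
  exact LETS.rootMultiplicity_charpoly_perronRoot hM.isIrreducible

end IsFinalClass

end FinalClass

section NormalForm

variable {ι : Type*} {M : Matrix ι ι ℝ} {t : ℕ} {b : ι → Fin t}

theorem le_of_transGen (hb : M.BlockTriangular b) {x y : ι}
    (hxy : TransGen (fun i j => 0 < M i j) x y) : b x ≤ b y := by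
  have hstep : ∀ {i j}, 0 < M i j → b i ≤ b j := fun h => not_lt.1 fun hlt => h.ne' (hb hlt)
  induction hxy with
  | single h => exact hstep h
  | tail _ h ih => exact ih.trans (hstep h)

theorem exists_surjective_eq_last_iff {p : ι → Prop} [Finite ι] (hp : ∃ y, p y) :
    ∃ (t : ℕ) (b : ι → Fin (t + 1)), Function.Surjective b ∧ (∀ x, b x = Fin.last t ↔ p x) ∧
      ∀ x y, b x = b y → ¬ p x → x = y := by
  classical
  have := Fintype.ofFinite ι
  let e := Fintype.equivFin {x // ¬ p x}
  let b : ι → Fin (Fintype.card {x // ¬ p x} + 1) := fun x =>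
    if h : p x then Fin.last _ else (e ⟨x, h⟩).castSucc
  have hb : ∀ x (hx : ¬ p x), b x = (e ⟨x, hx⟩).castSucc := fun x hx => dif_neg hx
  have hlast : ∀ x, b x = Fin.last _ ↔ p x := fun x =>
    ⟨fun hx => by_contra fun h => (Fin.castSucc_lt_last _).ne ((hb x h).symm.trans hx),
      fun hx => dif_pos hx⟩
  refine ⟨_, b, fun k => ?_, hlast, fun x y hxy hx => ?_⟩
  · induction k using Fin.lastCases with
    | last => exact hp.imp fun y hy => (hlast y).2 hy
    | cast k => exact ⟨e.symm k, by rw [hb _ (e.symm k).2, Subtype.coe_eta, e.apply_symm_apply]⟩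
  · have hy : ¬ p y := by rwa [← hlast, ← hxy, hlast]
    rw [hb x hx, hb y hy] at hxy
    exact congrArg Subtype.val (e.injective (Fin.castSucc_injective _ hxy))

namespace IsFinalClass

theorem exists_isFrobeniusNormalForm {p : ι → Prop} [Finite ι] (hM : IsFinalClass M p) :
    ∃ (t : ℕ) (b : ι → Fin t), IsFrobeniusNormalForm M b := by
  obtain ⟨t, b, hsurj, hlast, hinj⟩ := exists_surjective_eq_last_iff hM.exists_mem
  refine ⟨t + 1, b, hsurj, fun x y hxy => ?_, fun k => ?_⟩
  · refine hM.apply_eq_zero x y fun hy => ?_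
    rw [(hlast y).2 hy] at hxy
    exact (Fin.le_last _).not_gt hxy
  · obtain ⟨x, rfl⟩ := hsurj k
    by_cases hx : p x
    · have hpb : p = fun y => b y = b x := funext fun y => by rw [(hlast x).2 hx, hlast]
      subst hpb
      exact .inl hM.isIrreducible
    · refine .inr ⟨Nat.card_eq_one_iff_exists.2 ⟨⟨x, rfl⟩, fun y => ?_⟩, ?_⟩
      · exact Subtype.ext (hinj x y y.2.symm hx).symm
      · ext i j
        exact hM.apply_eq_zero i j (hinj x j j.2.symm hx ▸ hx)

theorem exists_block_eq {p : ι → Prop} (hM : IsFinalClass M p) (hb : IsFrobeniusNormalForm M b) :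
    ∃ k, (fun x => b x = k) = p ∧ (∀ k', (M.toSquareBlock b k').IsIrreducible → k' = k) ∧
      ∀ k', k' ≤ k := by
  obtain ⟨y, hy⟩ := hM.exists_mem
  have hle : ∀ x, b x ≤ b y := fun x => le_of_transGen hb.blockTriangular (hM.transGen x y hy)
  have heq : ∀ x, p x → b x = b y := fun x hx =>
    (hle x).antisymm (le_of_transGen hb.blockTriangular (hM.transGen y x hx))
  have hmem : ∀ x, (M.toSquareBlock b (b x)).IsIrreducible → p x := fun x hirr => by
    by_contra hx
    obtain ⟨w, -, hw⟩ := TransGen.tail'_iff.1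
      ((isIrreducible_iff_transGen.1 hirr).2 ⟨x, rfl⟩ ⟨x, rfl⟩)
    exact hw.ne' (hM.apply_eq_zero _ _ hx)
  refine ⟨b y, funext fun x => propext ⟨fun hx => ?_, heq x⟩, fun k' hirr => ?_, fun k' => ?_⟩
  · rcases hb.diagonal (b y) with hirr | ⟨hcard, -⟩
    · exact hmem x (hx ▸ hirr)
    · have hsub := (Nat.card_eq_one_iff_unique.1 hcard).1
      obtain rfl : x = y := congrArg Subtype.val (hsub.elim ⟨x, hx⟩ ⟨y, rfl⟩)
      exact hy
  · obtain ⟨x, rfl⟩ := hb.surjective k'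
    exact heq x (hmem x hirr)
  · obtain ⟨x, rfl⟩ := hb.surjective k'
    exact hle x

variable [Fintype ι] [DecidableEq ι] {k : Fin t}

theorem exists_pos_left_eigenvector (hM : IsFinalClass M fun x => b x = k) :
    ∃ ω : {x // b x = k} → ℝ, (∀ x, 0 < ω x) ∧
      ω ᵥ* M.toSquareBlock b k = perronRoot M • ω ∧
      (∀ x, 0 ≤ stack b k 0 ω x) ∧
      stack b k 0 ω ᵥ* M = perronRoot M • stack b k 0 ω ∧
      ∀ w, w ᵥ* M = perronRoot M • w → ∃ s : ℝ, w = s • stack b k 0 ω := by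
  have := hM.nonempty_subtype
  obtain ⟨ω, hω, hωM⟩ := exists_pos_vecMul_eq_perronRoot hM.isIrreducible
  rw [← hM.perronRoot_eq] at hωM
  refine ⟨ω, hω, hωM, stack_nonneg le_rfl fun x => (hω x).le,
    (vecMul_eq_smul_iff hM.apply_eq_zero hM.perronRoot_pos.ne').2 ⟨ω, hωM, rfl⟩, fun w hw => ?_⟩
  obtain ⟨ω', hω'M, rfl⟩ := (vecMul_eq_smul_iff hM.apply_eq_zero hM.perronRoot_pos.ne').1 hw
  rw [← mulVec_transpose] at hωM hω'M
  obtain ⟨s, rfl⟩ := eq_smul_of_mulVec_eq hM.isIrreducible.transpose hω hωM hω'M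
  exact ⟨s, by rw [smul_stack, smul_zero]⟩

theorem exists_pos_right_eigenvector (hM : IsFinalClass M fun x => b x = k) :
    ∃ ν : {x // b x = k} → ℝ, (∀ x, 0 < ν x) ∧
      M.toSquareBlock b k *ᵥ ν = perronRoot M • ν ∧
      (∀ x, 0 ≤ stack b k ((perronRoot M)⁻¹ •
        M.toBlock (fun x => b x ≠ k) (fun x => b x = k) *ᵥ ν) ν x) ∧
      M *ᵥ stack b k ((perronRoot M)⁻¹ •
          M.toBlock (fun x => b x ≠ k) (fun x => b x = k) *ᵥ ν) ν =
        perronRoot M • stack b k ((perronRoot M)⁻¹ •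
          M.toBlock (fun x => b x ≠ k) (fun x => b x = k) *ᵥ ν) ν ∧
      ∀ u, M *ᵥ u = perronRoot M • u → ∃ s : ℝ, u = s • stack b k ((perronRoot M)⁻¹ •
        M.toBlock (fun x => b x ≠ k) (fun x => b x = k) *ᵥ ν) ν := by
  have := hM.nonempty_subtype
  obtain ⟨ν, hν, hMν⟩ := exists_pos_mulVec_eq_perronRoot hM.isIrreducible
  rw [← hM.perronRoot_eq] at hMν
  refine ⟨ν, hν, hMν, stack_nonneg ?_ fun x => (hν x).le,
    (mulVec_eq_smul_iff hM.apply_eq_zero hM.perronRoot_pos.ne').2 ⟨ν, hMν, rfl⟩, fun u hu => ?_⟩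
  · exact smul_nonneg (inv_nonneg.2 hM.perronRoot_pos.le) fun x =>
      Finset.sum_nonneg fun y _ => mul_nonneg (hM.nonneg x y) (hν y).le
  · obtain ⟨ν', hMν', rfl⟩ := (mulVec_eq_smul_iff hM.apply_eq_zero hM.perronRoot_pos.ne').1 hu
    obtain ⟨s, rfl⟩ := eq_smul_of_mulVec_eq hM.isIrreducible hν hMν hMν'
    exact ⟨s, by rw [smul_stack, mulVec_smul, smul_comm s]⟩

end IsFinalClass

end NormalForm

section GaussSeidel

variable {ι α R : Type*} [Fintype ι] [DecidableEq ι] [LinearOrder α]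

theorem layer_induction {ι α : Type*} [Finite ι] [Preorder α] (ℓ : ι → α) {motive : ι → Prop}
    (ih : ∀ x, (∀ z, ℓ z < ℓ x → motive z) → motive x) (x : ι) : motive x := by
  have : IsTrans ι fun z x => ℓ z < ℓ x := ⟨fun _ _ _ => lt_trans⟩
  have : Std.Irrefl fun z x : ι => ℓ z < ℓ x := ⟨fun _ => lt_irrefl _⟩
  exact (Finite.wellFounded_of_trans_of_irrefl fun z x => ℓ z < ℓ x).induction x ih

section Semiring

variable [Semiring R]

/-- `M` is the transition matrix of one sweep of the iteration with matrix `A`: in the order of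
the layers `ℓ`, each entry `x` is recomputed by the row `A x` from the new values of the entries of
the earlier layers and the old values of the other entries. -/
def IsSweep (A M : Matrix ι ι R) (ℓ : ι → α) : Prop :=
  ∀ x y, M x y = ∑ z, A x z * if ℓ z < ℓ x then M z y else (1 : Matrix ι ι R) z y

/-- The matrix which updates the entries of layer `j` by the rows of `A` and keeps all others. -/
def updateLayer (A : Matrix ι ι R) (ℓ : ι → α) (j : α) : Matrix ι ι R :=
  Matrix.of fun x y => if ℓ x = j then A x y else (1 : Matrix ι ι R) x y

variable {A P : Matrix ι ι R} {ℓ : ι → α} {j : α} {x : ι}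

theorem updateLayer_mul_apply_of_ne (hx : ℓ x ≠ j) (y : ι) :
    (updateLayer A ℓ j * P) x y = P x y := by
  simp [updateLayer, mul_apply, hx, one_apply]

theorem updateLayer_mul_apply_of_eq (hx : ℓ x = j) (y : ι) :
    (updateLayer A ℓ j * P) x y = (A * P) x y := by
  simp [updateLayer, mul_apply, hx]

theorem prod_updateLayer_apply (A : Matrix ι ι R) (ℓ : ι → α) {l : List α}
    (hl : l.Pairwise (· > ·)) (x y : ι) :
    (l.map (updateLayer A ℓ)).prod x y =
      if ℓ x ∈ l then
        ∑ z, A x z * if ℓ z < ℓ x then (l.map (updateLayer A ℓ)).prod z y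
          else (1 : Matrix ι ι R) z y
      else (1 : Matrix ι ι R) x y := by
  induction l generalizing x with
  | nil => simp
  | cons a l ih =>
    obtain ⟨ha, hl⟩ := List.pairwise_cons.1 hl
    rw [List.map_cons, List.prod_cons]
    by_cases hx : ℓ x = a
    · rw [updateLayer_mul_apply_of_eq hx, if_pos (by simp [hx]), mul_apply]
      refine Finset.sum_congr rfl fun z _ => congrArg (A x z * ·) ?_
      split_ifs with hz
      · rw [updateLayer_mul_apply_of_ne (hx ▸ hz.ne)]
      · rw [ih hl, if_neg fun hzl => hz (hx ▸ ha _ hzl)]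
    · rw [updateLayer_mul_apply_of_ne hx, ih hl]
      simp only [List.mem_cons, hx, false_or]
      split_ifs with hxl
      · refine Finset.sum_congr rfl fun z _ => congrArg (A x z * ·) ?_
        refine ite_congr rfl (fun hz => ?_) fun _ => rfl
        rw [updateLayer_mul_apply_of_ne (hz.trans (ha _ hxl)).ne]
      · rfl

theorem isSweep_prod_updateLayer (A : Matrix ι ι R) (ℓ : ι → α) {l : List α}
    (hl : l.Pairwise (· > ·)) (hmem : ∀ x, ℓ x ∈ l) :
    IsSweep A (l.map (updateLayer A ℓ)).prod ℓ := fun x y => by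
  conv_lhs => rw [prod_updateLayer_apply A ℓ hl, if_pos (hmem x)]

namespace IsSweep

variable {M : Matrix ι ι R}

theorem apply_eq_zero (h : IsSweep A M ℓ) {y : ι} (hy : ∀ z, A z y ≠ 0 → ℓ y < ℓ z) (x : ι) :
    M x y = 0 := by
  induction x using layer_induction ℓ with
  | ih x ih =>
    rw [h x y]
    refine Finset.sum_eq_zero fun z _ => ?_
    split_ifs with hz
    · rw [ih z hz, mul_zero]
    · rcases eq_or_ne z y with rfl | hzy
      · rw [not_imp_comm.1 (hy x) hz, zero_mul]
      · rw [one_apply_ne hzy, mul_zero]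

theorem sum_apply_eq (h : IsSweep A M ℓ) (x : ι) :
    ∑ y, M x y = ∑ z, A x z * if ℓ z < ℓ x then ∑ y, M z y else 1 := by
  simp_rw [h x]
  rw [Finset.sum_comm]
  refine Finset.sum_congr rfl fun z _ => ?_
  rw [← Finset.mul_sum]
  split_ifs
  · rfl
  · simp [one_apply]

end IsSweep

end Semiring

namespace IsSweep

variable [Ring R] [LinearOrder R] [IsStrictOrderedRing R] {A M : Matrix ι ι R} {ℓ : ι → α}

theorem apply_nonneg (h : IsSweep A M ℓ) (hA : ∀ x y, 0 ≤ A x y) (x y : ι) : 0 ≤ M x y := by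
  induction x using layer_induction ℓ with
  | ih x ih =>
    rw [h x y]
    refine Finset.sum_nonneg fun z _ => mul_nonneg (hA x z) ?_
    split_ifs with hz
    · exact ih z hz
    · exact zero_le_one_elem z y

theorem mul_le_apply (h : IsSweep A M ℓ) (hA : ∀ x y, 0 ≤ A x y) (x y z : ι) :
    A x z * (if ℓ z < ℓ x then M z y else (1 : Matrix ι ι R) z y) ≤ M x y := by
  rw [h x y]
  refine Finset.single_le_sum
    (f := fun z => A x z * if ℓ z < ℓ x then M z y else (1 : Matrix ι ι R) z y)
    (fun z _ => mul_nonneg (hA x z) ?_) (Finset.mem_univ z)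
  split_ifs
  · exact h.apply_nonneg hA z y
  · exact zero_le_one_elem z y

theorem apply_pos_of_lt (h : IsSweep A M ℓ) (hA : ∀ x y, 0 ≤ A x y) {x y z : ι}
    (hxz : 0 < A x z) (hlt : ℓ z < ℓ x) (hzy : 0 < M z y) : 0 < M x y := by
  have hle := h.mul_le_apply hA x y z
  rw [if_pos hlt] at hle
  exact (mul_pos hxz hzy).trans_le hle

theorem apply_pos_of_le (h : IsSweep A M ℓ) (hA : ∀ x y, 0 ≤ A x y) {x y : ι}
    (hxy : 0 < A x y) (hle : ℓ x ≤ ℓ y) : 0 < M x y := by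
  have hle' := h.mul_le_apply hA x y y
  rw [if_neg hle.not_gt, one_apply_eq, mul_one] at hle'
  exact hxy.trans_le hle'

theorem transGen_of_reflTransGen (h : IsSweep A M ℓ) (hA : ∀ x y, 0 ≤ A x y) {x y z : ι}
    (hxz : ReflTransGen (fun i j => 0 < A i j) x z) (hzy : 0 < A z y) (hle : ℓ z ≤ ℓ y) :
    TransGen (fun i j => 0 < M i j) x y := by
  induction hxz using ReflTransGen.head_induction_on with
  | refl => exact .single (h.apply_pos_of_le hA hzy hle)
  | @head x x' hxx' _ ih =>
    rcases lt_or_ge (ℓ x') (ℓ x) with hlt | hge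
    · obtain ⟨w, hw, hwy⟩ := TransGen.head'_iff.1 ih
      exact TransGen.head' (h.apply_pos_of_lt hA hxx' hlt hw) hwy
    · exact ih.head (h.apply_pos_of_le hA hxx' hge)

end IsSweep

/-- The entries whose old value is still used in a sweep, because some entry depending on them is
updated no later than they are. -/
def IsCarriedOver [Zero R] (A : Matrix ι ι R) (ℓ : ι → α) (y : ι) : Prop :=
  ∃ x, A x y ≠ 0 ∧ ℓ x ≤ ℓ y

namespace IsSweep

variable [Ring R] [LinearOrder R] [IsStrictOrderedRing R] {A M : Matrix ι ι R} {ℓ : ι → α}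

theorem isFinalClass [Nonempty ι] (h : IsSweep A M ℓ) (hA : A.IsIrreducible) :
    IsFinalClass M (IsCarriedOver A ℓ) where
  nonneg := h.apply_nonneg hA.nonneg
  exists_mem := by
    obtain ⟨y, hy⟩ := Finite.exists_max ℓ
    obtain ⟨x, -, hxy⟩ := TransGen.tail'_iff.1 ((isIrreducible_iff_transGen.1 hA).2 y y)
    exact ⟨y, x, hxy.ne', hy x⟩
  apply_eq_zero x y hy := h.apply_eq_zero (fun z hzy => not_le.1 fun hle => hy ⟨z, hzy, hle⟩) x
  transGen x y hy := by
    obtain ⟨z, hzy, hle⟩ := hy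
    have hxz := ((isIrreducible_iff_transGen.1 hA).2 x z).to_reflTransGen
    exact h.transGen_of_reflTransGen hA.nonneg hxz ((hA.nonneg z y).lt_of_ne' hzy) hle

theorem one_le_sum_apply (h : IsSweep A M ℓ) (hA : ∀ x y, 0 ≤ A x y)
    (hrow : ∀ x, 1 ≤ ∑ y, A x y) (x : ι) : 1 ≤ ∑ y, M x y := by
  induction x using layer_induction ℓ with
  | ih x ih =>
    rw [h.sum_apply_eq]
    refine (hrow x).trans (Finset.sum_le_sum fun z _ => le_mul_of_one_le_right (hA x z) ?_)
    split_ifs with hz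
    · exact ih z hz
    · exact le_rfl

theorem sum_apply_le (h : IsSweep A M ℓ) (hA : ∀ x y, 0 ≤ A x y)
    (hrow : ∀ x, 1 ≤ ∑ y, A x y) (x : ι) : ∑ y, A x y ≤ ∑ y, M x y := by
  rw [h.sum_apply_eq]
  refine Finset.sum_le_sum fun z _ => le_mul_of_one_le_right (hA x z) ?_
  split_ifs with hz
  · exact h.one_le_sum_apply hA hrow z
  · exact le_rfl

theorem sum_apply_le_of_lt (h : IsSweep A M ℓ) (hA : ∀ x y, 0 ≤ A x y) {x z : ι}
    (hxz : 1 ≤ A x z) (hlt : ℓ z < ℓ x) : ∑ y, M z y ≤ ∑ y, M x y :=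
  Finset.sum_le_sum fun y _ => by
    refine le_trans ?_ (h.mul_le_apply hA x y z)
    rw [if_pos hlt]
    exact le_mul_of_one_le_left (h.apply_nonneg hA z y) hxz

-- Among the rows of `M` with sum larger than one, choose one in the last possible layer.
theorem exists_isCarriedOver_one_lt_sum_apply (h : IsSweep A M ℓ) (hA : A.IsIrreducible)
    (hA1 : ∀ x y, A x y ≠ 0 → 1 ≤ A x y) (hrow : ∀ x, 1 ≤ ∑ y, A x y)
    (hlarge : ∃ x, 1 < ∑ y, A x y) : ∃ x, IsCarriedOver A ℓ x ∧ 1 < ∑ y, M x y := by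
  obtain ⟨x₀, hx₀⟩ := hlarge
  obtain ⟨x, hx, hmax⟩ := (Finset.univ.filter fun x => 1 < ∑ y, M x y).exists_max_image ℓ
    ⟨x₀, by simpa using hx₀.trans_le (h.sum_apply_le hA.nonneg hrow x₀)⟩
  simp only [Finset.mem_filter, Finset.mem_univ, true_and] at hx hmax
  obtain ⟨z, -, hzx⟩ := TransGen.tail'_iff.1 ((isIrreducible_iff_transGen.1 hA).2 x x)
  refine ⟨x, ⟨z, hzx.ne', not_lt.1 fun hlt => (hmax z (hx.trans_le ?_)).not_gt hlt⟩, hx⟩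
  exact h.sum_apply_le_of_lt hA.nonneg (hA1 z x hzx.ne') hlt

end IsSweep

end GaussSeidel

section Balanced

theorem mem_of_mem_doublyStochastic {ι R : Type*} [Fintype ι] [DecidableEq ι] [Ring R]
    [LinearOrder R] [IsStrictOrderedRing R] {P : Matrix ι ι R} (hP : P ∈ doublyStochastic R ι)
    {T : Finset ι} (hT : ∀ x ∈ T, ∀ y, P x y ≠ 0 → y ∈ T) {x y : ι} (hxy : P x y ≠ 0)
    (hy : y ∈ T) : x ∈ T := by
  have hstay : ∀ x ∈ T, ∑ y ∈ T, P x y = 1 := fun x hx =>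
    (Finset.sum_subset (Finset.subset_univ T) fun y _ hy => not_imp_comm.1 (hT x hx y) hy).trans
      (sum_row_of_mem_doublyStochastic hP x)
  have hinflow : ∑ x ∈ Tᶜ, ∑ y ∈ T, P x y = 0 := by
    have htotal : ∑ x, ∑ y ∈ T, P x y = ∑ x ∈ T, ∑ y ∈ T, P x y := by
      rw [Finset.sum_congr rfl hstay]
      exact Finset.sum_comm.trans
        (Finset.sum_congr rfl fun y _ => sum_col_of_mem_doublyStochastic hP y)
    rwa [← Finset.sum_add_sum_compl T, add_eq_left] at htotal
  by_contra hx
  have hnonneg : ∀ x y, 0 ≤ P x y := fun x y => nonneg_of_mem_doublyStochastic hP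
  have hrow := (Finset.sum_eq_zero_iff_of_nonneg fun x _ =>
    Finset.sum_nonneg fun y _ => hnonneg x y).1 hinflow x (Finset.mem_compl.2 hx)
  exact hxy ((Finset.sum_eq_zero_iff_of_nonneg fun y _ => hnonneg x y).1 hrow y hy)

variable {E : Type*} {r : E → E → Prop}

theorem exists_mem_doublyStochastic_of_ncard_eq [Fintype E] [DecidableEq E]
    (hout : ∀ x, ∃ y, r x y) (hin : ∀ y, ∃ x, r x y)
    (hcard : ∀ x y, r x y → {z | r x z}.ncard = {z | r z y}.ncard) :
    ∃ P ∈ doublyStochastic ℝ E, ∀ x y, P x y ≠ 0 ↔ r x y := by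
  classical
  have hout' : ∀ x, ({z | r x z}.ncard : ℝ) ≠ 0 := fun x =>
    Nat.cast_ne_zero.2 (Set.ncard_ne_zero_of_mem (hout x).choose_spec)
  refine ⟨.of fun x y => if r x y then ({z | r x z}.ncard : ℝ)⁻¹ else 0,
    mem_doublyStochastic_iff_sum.2 ⟨fun x y => ?_, fun x => ?_, fun y => ?_⟩, fun x y => ?_⟩
  · rw [of_apply]
    positivity
  · simp only [of_apply, ← Finset.sum_filter, Finset.sum_const, nsmul_eq_mul]
    rw [← Set.ncard_coe_finset, Finset.coe_filter_univ, mul_inv_cancel₀ (hout' x)]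
  · obtain ⟨x₀, hx₀⟩ := hin y
    have hterm : ∀ x, (if r x y then ({z | r x z}.ncard : ℝ)⁻¹ else 0) =
        if r x y then ({z | r z y}.ncard : ℝ)⁻¹ else 0 := fun x =>
      ite_congr rfl (fun h => by rw [hcard x y h]) fun _ => rfl
    simp only [of_apply, hterm, ← Finset.sum_filter, Finset.sum_const, nsmul_eq_mul]
    rw [← Set.ncard_coe_finset, Finset.coe_filter_univ, ← hcard x₀ y hx₀,
      mul_inv_cancel₀ (hout' x₀)]
  · simp [hout' x]

theorem reflTransGen_symm_of_ncard_eq [Finite E] (hout : ∀ x, ∃ y, r x y)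
    (hin : ∀ y, ∃ x, r x y) (hcard : ∀ x y, r x y → {z | r x z}.ncard = {z | r z y}.ncard)
    {x y : E} (hxy : ReflTransGen r x y) : ReflTransGen r y x := by
  classical
  have := Fintype.ofFinite E
  obtain ⟨P, hP, hPr⟩ := exists_mem_doublyStochastic_of_ncard_eq hout hin hcard
  have hclosed : ∀ x ∈ Finset.univ.filter (ReflTransGen r y), ∀ z, P x z ≠ 0 →
      z ∈ Finset.univ.filter (ReflTransGen r y) := fun x hx z hz => by
    simp only [Finset.mem_filter, Finset.mem_univ, true_and] at hx ⊢
    exact hx.tail ((hPr x z).1 hz)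
  induction hxy using ReflTransGen.head_induction_on with
  | refl => exact .refl
  | @head x x' hxx' _ ih =>
    simpa using mem_of_mem_doublyStochastic hP hclosed ((hPr x x').2 hxx') (by simpa using ih)

end Balanced

section NonBacktracking

variable {E W : Type*} {rev : E → E} {τ : E → W}

/-- In a multigraph whose arcs `E` have the initial vertices `τ` and the reversal `rev`, the
relation that the arc `x` can follow the arc `y` in a non-backtracking walk. -/
def Follows (rev : E → E) (τ : E → W) (x y : E) : Prop :=
  τ x = τ (rev y) ∧ x ≠ rev y

theorem follows_rev_iff (hrev : Function.Involutive rev) {x z : E} :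
    Follows rev τ x (rev z) ↔ τ x = τ z ∧ x ≠ z := by
  rw [Follows, hrev]

theorem ncard_setOf_follows_eq [Finite E] (hrev : Function.Involutive rev) {x y : E}
    (hxy : Follows rev τ x y) :
    {z | Follows rev τ x z}.ncard = {z | Follows rev τ z y}.ncard := by
  have hout : {z | Follows rev τ x z} = rev '' ({z | τ z = τ (rev y)} \ {x}) := by
    ext z
    rw [hrev.image_eq_preimage_symm]
    simp [Follows, hxy.1, eq_comm]
  have hin : {z | Follows rev τ z y} = {z | τ z = τ (rev y)} \ {rev y} := by
    ext z
    simp [Follows]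
  have herase : ∀ a, τ a = τ (rev y) →
      ({z | τ z = τ (rev y)} \ {a}).ncard = {z | τ z = τ (rev y)}.ncard - 1 :=
    fun a ha => Set.ncard_sdiff_singleton_of_mem ha
  rw [hout, hin, Set.ncard_image_of_injective _ hrev.injective, herase _ hxy.1, herase _ rfl]

theorem reflTransGen_follows_symm [Finite E] (hrev : Function.Involutive rev)
    (hdeg : ∀ x, ∃ z, z ≠ x ∧ τ z = τ x) {x y : E} (hxy : ReflTransGen (Follows rev τ) x y) :
    ReflTransGen (Follows rev τ) y x := by
  refine reflTransGen_symm_of_ncard_eq (fun x => ?_) (fun y => ?_)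
    (fun _ _ => ncard_setOf_follows_eq hrev) hxy
  · obtain ⟨z, hne, hτ⟩ := hdeg x
    exact ⟨rev z, (follows_rev_iff hrev).2 ⟨hτ.symm, hne.symm⟩⟩
  · obtain ⟨z, hne, hτ⟩ := hdeg (rev y)
    exact ⟨z, hτ, hne⟩

-- At a vertex with three arcs `e`, `a`, `b` the chain `rev e, b, rev a, e` reverses the direction;
-- its first and last steps come from the symmetry of reachability.
theorem reflTransGen_follows [Finite E] (hrev : Function.Involutive rev)
    (hdeg : ∀ x, ∃ z, z ≠ x ∧ τ z = τ x)
    (hdeg₃ : ∃ x y z, x ≠ y ∧ x ≠ z ∧ y ≠ z ∧ τ x = τ y ∧ τ x = τ z)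
    (hconn : ∀ G : W → Prop, (∃ x, G (τ x)) → (∀ x, G (τ x) → G (τ (rev x))) → ∀ x, G (τ x))
    (x y : E) : ReflTransGen (Follows rev τ) x y := by
  have symm : ∀ {x y}, ReflTransGen (Follows rev τ) x y → ReflTransGen (Follows rev τ) y x :=
    reflTransGen_follows_symm hrev hdeg
  have turn : ∀ {x z}, τ x = τ z → x ≠ z → ReflTransGen (Follows rev τ) x (rev z) :=
    fun hτ hne => .single ((follows_rev_iff hrev).2 ⟨hτ, hne⟩)
  obtain ⟨e, a, b, hea, heb, hab, hτa, hτb⟩ := hdeg₃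
  let G : W → Prop := fun v => ∀ x, τ x = v →
    ReflTransGen (Follows rev τ) x e ∧ ReflTransGen (Follows rev τ) (rev x) e
  have spread : ∀ x, ReflTransGen (Follows rev τ) x e → ReflTransGen (Follows rev τ) (rev x) e →
      G (τ x) := by
    intro x hx hx' z hz
    rcases eq_or_ne z x with rfl | hne
    · exact ⟨hx, hx'⟩
    · exact ⟨(turn hz hne).trans hx', (symm (turn hz.symm hne.symm)).trans hx⟩
  have he : ReflTransGen (Follows rev τ) (rev e) e :=
    calc ReflTransGen (Follows rev τ) (rev e) b := symm (turn hτb.symm heb.symm)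
      ReflTransGen (Follows rev τ) _ (rev a) := turn (hτb.symm.trans hτa) hab.symm
      ReflTransGen (Follows rev τ) _ e := symm (turn hτa hea)
  have hG := hconn G ⟨e, spread e .refl he⟩ fun x hx =>
    spread (rev x) (hx x rfl).2 (by rw [hrev]; exact (hx x rfl).1)
  exact (hG x x rfl).1.trans (symm (hG y y rfl).1)

end NonBacktracking

section StateVariables

theorem forall_of_preconnected {W : Type*} {G : SimpleGraph W} (hG : G.Preconnected)
    {p : W → Prop} (hp : ∀ u v, G.Adj u v → p u → p v) {u : W} (hu : p u) (v : W) : p v := by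
  obtain ⟨walk⟩ := hG u v
  induction walk with
  | nil => exact hu
  | cons hadj _ ih => exact ih (hp _ _ hadj hu)

variable {C V : Type*} [Fintype C] {H : Matrix C V (ZMod 2)} {S : Finset V}

namespace IsLETS

theorem checkDegree_eq_two (hS : IsLETS H S) {c : C} (hc : c ∈ missatisfied H S) :
    checkDegree H S c = 2 := by
  obtain ⟨hΓ, heven⟩ := Finset.mem_filter.1 hc
  refine (hS.elementary c hΓ).resolve_left fun h => ?_
  rw [h] at heven
  exact Nat.not_even_one heven

theorem mem_missatisfied_of_ne (hS : IsLETS H S) {c : C} {v v' : V} (hv : v ∈ S) (hv' : v' ∈ S)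
    (hvv' : v ≠ v') (hcv : H c v = 1) (hcv' : H c v' = 1) : c ∈ missatisfied H S := by
  have hdeg : 1 < checkDegree H S c := Finset.one_lt_card.2
    ⟨v, Finset.mem_filter.2 ⟨hv, hcv⟩, v', Finset.mem_filter.2 ⟨hv', hcv'⟩, hvv'⟩
  have hΓ : c ∈ checkNeighbors H S := Finset.mem_filter.2 ⟨Finset.mem_univ c, hdeg.le⟩
  refine Finset.mem_filter.2 ⟨hΓ, ?_⟩
  rw [(hS.elementary c hΓ).resolve_left hdeg.ne']
  exact even_two

theorem exists_reverse (hS : IsLETS H S) (x : StateVar H S) :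
    ∃ y : StateVar H S, y.1.2 = x.1.2 ∧ y.1.1 ≠ x.1.1 := by
  have hdeg := hS.checkDegree_eq_two x.2.2.1
  obtain ⟨v, hv, hne⟩ := Finset.exists_mem_ne (hdeg ▸ one_lt_two) x.1.1
  obtain ⟨hvS, hcv⟩ := Finset.mem_filter.1 hv
  exact ⟨⟨(v, x.1.2), hvS, x.2.2.1, hcv⟩, rfl, hne⟩

/-- The state variable of the other edge at the same check node. State variables are regarded as
arcs of a multigraph on `S`, which start at their variable node and run through their check node;
this is the reversal of arcs. -/
noncomputable def reverse (hS : IsLETS H S) (x : StateVar H S) : StateVar H S :=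
  (hS.exists_reverse x).choose

theorem reverse_check (hS : IsLETS H S) (x : StateVar H S) : (hS.reverse x).1.2 = x.1.2 :=
  (hS.exists_reverse x).choose_spec.1

theorem reverse_variable_ne (hS : IsLETS H S) (x : StateVar H S) :
    (hS.reverse x).1.1 ≠ x.1.1 :=
  (hS.exists_reverse x).choose_spec.2

theorem reverse_eq (hS : IsLETS H S) {x y : StateVar H S} (hc : y.1.2 = x.1.2)
    (hv : y.1.1 ≠ x.1.1) : hS.reverse x = y := by
  refine Subtype.ext (Prod.ext ?_ ((hS.reverse_check x).trans hc.symm))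
  by_contra hne
  have hdeg : 2 < checkDegree H S x.1.2 := Finset.two_lt_card.2
    ⟨x.1.1, Finset.mem_filter.2 ⟨x.2.1, x.2.2.2⟩,
      _, Finset.mem_filter.2 ⟨(hS.reverse x).2.1, hS.reverse_check x ▸ (hS.reverse x).2.2.2⟩,
      y.1.1, Finset.mem_filter.2 ⟨y.2.1, hc ▸ y.2.2.2⟩, (hS.reverse_variable_ne x).symm, hv.symm,
      hne⟩
  exact hdeg.ne' (hS.checkDegree_eq_two x.2.2.1)

theorem reverse_involutive (hS : IsLETS H S) : Function.Involutive hS.reverse := fun x =>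
  hS.reverse_eq (hS.reverse_check x).symm (hS.reverse_variable_ne x).symm

theorem exists_ne_variable_eq (hS : IsLETS H S) (x : StateVar H S) :
    ∃ z, z ≠ x ∧ z.1.1 = x.1.1 := by
  obtain ⟨c, hc, hne⟩ := Finset.exists_mem_ne (hS.leafless x.1.1 x.2.1) x.1.2
  obtain ⟨hcm, hcv⟩ := Finset.mem_filter.1 hc
  exact ⟨⟨(x.1.1, c), x.2.1, hcm, hcv⟩, fun h => hne (congrArg (fun z => z.1.2) h), rfl⟩

theorem exists_three_variable_eq (hS : IsLETS H S) (hconn : (inducedSubgraph H S).Connected)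
    (hcycle : ¬ IsSimpleCycle H S) :
    ∃ x y z : StateVar H S, x ≠ y ∧ x ≠ z ∧ y ≠ z ∧ x.1.1 = y.1.1 ∧ x.1.1 = z.1.1 := by
  obtain ⟨v, hv, hne⟩ : ∃ v ∈ S, missatisfiedDegree H S v ≠ 2 := by
    by_contra! h
    exact hcycle ⟨hS, hconn, h⟩
  obtain ⟨c₁, h₁, c₂, h₂, c₃, h₃, h₁₂, h₁₃, h₂₃⟩ :=
    Finset.two_lt_card.1 ((hS.leafless v hv).lt_of_ne hne.symm)
  rw [Finset.mem_filter] at h₁ h₂ h₃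
  exact ⟨⟨(v, c₁), hv, h₁⟩, ⟨(v, c₂), hv, h₂⟩, ⟨(v, c₃), hv, h₃⟩,
    fun h => h₁₂ (congrArg (fun z => z.1.2) h), fun h => h₁₃ (congrArg (fun z => z.1.2) h),
    fun h => h₂₃ (congrArg (fun z => z.1.2) h), rfl, rfl⟩

theorem exists_reverse_variable_eq (hS : IsLETS H S) {c : C} {v v' : V} (hv : v ∈ S)
    (hv' : v' ∈ S) (hvv' : v ≠ v') (hcv : H c v = 1) (hcv' : H c v' = 1) :
    ∃ x : StateVar H S, x.1.1 = v ∧ (hS.reverse x).1.1 = v' := by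
  have hc := hS.mem_missatisfied_of_ne hv hv' hvv' hcv hcv'
  let x : StateVar H S := ⟨(v, c), hv, hc, hcv⟩
  let y : StateVar H S := ⟨(v', c), hv', hc, hcv'⟩
  exact ⟨x, rfl, congrArg (fun z => z.1.1) (hS.reverse_eq (x := x) (y := y) rfl hvv'.symm)⟩

theorem variable_induction (hS : IsLETS H S) (hconn : (inducedSubgraph H S).Connected)
    (G : V → Prop) (hbase : ∃ x : StateVar H S, G x.1.1)
    (hstep : ∀ x : StateVar H S, G x.1.1 → G (hS.reverse x).1.1) (x : StateVar H S) :
    G x.1.1 := by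
  let good : V ⊕ C → Prop := Sum.elim G fun c => ∃ v ∈ S, H c v = 1 ∧ G v
  have hgood : ∀ p q, (inducedSubgraph H S).Adj p q → good p.1 → good q.1 := by
    rintro ⟨p, hp⟩ ⟨q, hq⟩ hpq hgp
    rcases hpq with ⟨v, c, rfl, rfl, hcv⟩ | ⟨v, c, rfl, rfl, hcv⟩
    · exact ⟨v, by simpa using hp, hcv, hgp⟩
    · obtain ⟨v', hv', hcv', hGv'⟩ := hgp
      rcases eq_or_ne v' v with rfl | hne
      · exact hGv'
      · obtain ⟨y, rfl, rfl⟩ :=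
          hS.exists_reverse_variable_eq hv' (by simpa using hq) hne hcv' hcv
        exact hstep y hGv'
  obtain ⟨x₀, hx₀⟩ := hbase
  exact forall_of_preconnected hconn.preconnected (p := fun q => good q.1) hgood
    (u := ⟨.inl x₀.1.1, .inl ⟨_, x₀.2.1, rfl⟩⟩) hx₀ ⟨.inl x.1.1, .inl ⟨_, x.2.1, rfl⟩⟩

end IsLETS

variable [DecidableEq C] [DecidableEq V]

theorem floodingMatrix_ne_zero_iff (x y : StateVar H S) :
    floodingMatrix H S x y ≠ 0 ↔ y.1.2 ≠ x.1.2 ∧ y.1.1 ≠ x.1.1 ∧ H y.1.2 x.1.1 = 1 := by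
  rw [floodingMatrix, of_apply, ne_eq, ite_eq_right_iff, Classical.not_imp,
    and_iff_left one_ne_zero]

theorem floodingMatrix_eq_one_of_ne_zero {x y : StateVar H S} (h : floodingMatrix H S x y ≠ 0) :
    floodingMatrix H S x y = 1 :=
  if_pos ((floodingMatrix_ne_zero_iff x y).1 h)

theorem floodingMatrix_nonneg (x y : StateVar H S) : 0 ≤ floodingMatrix H S x y := by
  rw [floodingMatrix, of_apply]
  positivity

theorem isSweep_layeredMatrix [Fintype V] {mb : ℕ} (layer : C → Fin mb) :
    IsSweep (floodingMatrix H S) (layeredMatrix H layer S) fun x => layer x.1.2 :=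
  isSweep_prod_updateLayer (floodingMatrix H S) (fun x : StateVar H S => layer x.1.2)
    (Finset.sortedGT_sort _).pairwise
    fun x => (Finset.mem_sort _).2 (Finset.mem_image_of_mem layer x.2.2.1)

open Classical in
theorem card_not_isCarriedOver_floodingMatrix [Fintype V] {mb : ℕ} (layer : C → Fin mb) :
    Nat.card {x // ¬ IsCarriedOver (floodingMatrix H S) (fun x => layer x.1.2) x} =
      nz H layer S := by
  rw [Nat.card_eq_fintype_card, Fintype.card_subtype, nz]
  simp [IsCarriedOver]

namespace IsLETS

theorem floodingMatrix_ne_zero_iff_follows (hS : IsLETS H S) (x y : StateVar H S) :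
    floodingMatrix H S x y ≠ 0 ↔ Follows hS.reverse (fun x => x.1.1) x y := by
  rw [floodingMatrix_ne_zero_iff]
  constructor
  · rintro ⟨hc, hv, hH⟩
    have hrev : hS.reverse y = ⟨(x.1.1, y.1.2), x.2.1, y.2.2.1, hH⟩ := hS.reverse_eq rfl hv.symm
    rw [Follows, hrev]
    exact ⟨rfl, fun h => hc (congrArg (fun z => z.1.2) h).symm⟩
  · rintro ⟨hv, hne⟩
    refine ⟨fun hc => hne ?_, fun h => hS.reverse_variable_ne y (h.trans hv).symm, ?_⟩
    · exact Subtype.ext (Prod.ext hv (hc.symm.trans (hS.reverse_check y).symm))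
    · rw [show x.1.1 = (hS.reverse y).1.1 from hv, ← hS.reverse_check y]
      exact (hS.reverse y).2.2.2

theorem floodingMatrix_reverse (hS : IsLETS H S) {x z : StateVar H S} (hne : x ≠ z)
    (hv : x.1.1 = z.1.1) : floodingMatrix H S x (hS.reverse z) = 1 :=
  floodingMatrix_eq_one_of_ne_zero <| (hS.floodingMatrix_ne_zero_iff_follows _ _).2 <|
    (follows_rev_iff hS.reverse_involutive).2 ⟨hv, hne⟩

theorem isIrreducible_floodingMatrix [Finite V] (hS : IsLETS H S)
    (hconn : (inducedSubgraph H S).Connected) (hcycle : ¬ IsSimpleCycle H S) :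
    (floodingMatrix H S).IsIrreducible := by
  refine isIrreducible_iff_transGen.2 ⟨floodingMatrix_nonneg, fun x y => ?_⟩
  have hpos : ∀ {x y}, Follows hS.reverse (fun x => x.1.1) x y → 0 < floodingMatrix H S x y :=
    fun {x y} h =>
      (floodingMatrix_nonneg x y).lt_of_ne' ((hS.floodingMatrix_ne_zero_iff_follows x y).2 h)
  obtain ⟨z, hne, hv⟩ := hS.exists_ne_variable_eq (hS.reverse y)
  have hxz := reflTransGen_follows hS.reverse_involutive hS.exists_ne_variable_eq
    (hS.exists_three_variable_eq hconn hcycle) (hS.variable_induction hconn) x z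
  exact TransGen.tail' (ReflTransGen.mono (fun _ _ => hpos) _ _ hxz) (hpos ⟨hv, hne⟩)

variable [Fintype V]

theorem one_le_sum_floodingMatrix (hS : IsLETS H S) (x : StateVar H S) :
    1 ≤ ∑ y, floodingMatrix H S x y := by
  obtain ⟨z, hne, hv⟩ := hS.exists_ne_variable_eq x
  rw [← hS.floodingMatrix_reverse hne.symm hv.symm]
  exact Finset.single_le_sum (fun y _ => floodingMatrix_nonneg x y) (Finset.mem_univ _)

theorem exists_one_lt_sum_floodingMatrix (hS : IsLETS H S)
    (hconn : (inducedSubgraph H S).Connected) (hcycle : ¬ IsSimpleCycle H S) :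
    ∃ x, 1 < ∑ y, floodingMatrix H S x y := by
  obtain ⟨x, y, z, hxy, hxz, hyz, hvy, hvz⟩ := hS.exists_three_variable_eq hconn hcycle
  refine ⟨x, ?_⟩
  calc (1 : ℝ) < 1 + 1 := by norm_num
    _ = ∑ w ∈ {hS.reverse y, hS.reverse z}, floodingMatrix H S x w := by
      rw [Finset.sum_pair (hS.reverse_involutive.injective.ne hyz),
        hS.floodingMatrix_reverse hxy hvy, hS.floodingMatrix_reverse hxz hvz]
    _ ≤ ∑ w, floodingMatrix H S x w :=
      Finset.sum_le_sum_of_subset_of_nonneg (Finset.subset_univ _)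
        fun w _ _ => floodingMatrix_nonneg x w

theorem isFinalClass_layeredMatrix (hS : IsLETS H S) (hconn : (inducedSubgraph H S).Connected)
    (hcycle : ¬ IsSimpleCycle H S) {mb : ℕ} (layer : C → Fin mb) :
    IsFinalClass (layeredMatrix H layer S)
      (IsCarriedOver (floodingMatrix H S) fun x => layer x.1.2) := by
  obtain ⟨x, -⟩ := hS.exists_three_variable_eq hconn hcycle
  have : Nonempty (StateVar H S) := ⟨x⟩
  exact (isSweep_layeredMatrix layer).isFinalClass (hS.isIrreducible_floodingMatrix hconn hcycle)

theorem one_le_sum_layeredMatrix (hS : IsLETS H S) {mb : ℕ} (layer : C → Fin mb)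
    (x : StateVar H S) : 1 ≤ ∑ y, layeredMatrix H layer S x y :=
  (isSweep_layeredMatrix layer).one_le_sum_apply floodingMatrix_nonneg
    hS.one_le_sum_floodingMatrix x

theorem exists_isCarriedOver_one_lt_sum_layeredMatrix (hS : IsLETS H S)
    (hconn : (inducedSubgraph H S).Connected) (hcycle : ¬ IsSimpleCycle H S) {mb : ℕ}
    (layer : C → Fin mb) :
    ∃ x, IsCarriedOver (floodingMatrix H S) (fun x => layer x.1.2) x ∧
      1 < ∑ y, layeredMatrix H layer S x y :=
  (isSweep_layeredMatrix layer).exists_isCarriedOver_one_lt_sum_apply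
    (hS.isIrreducible_floodingMatrix hconn hcycle)
    (fun _ _ h => (floodingMatrix_eq_one_of_ne_zero h).ge) hS.one_le_sum_floodingMatrix
    (hS.exists_one_lt_sum_floodingMatrix hconn hcycle)

end IsLETS

end StateVariables

end LETS

theorem mainTheorem1 {C V : Type*} [Fintype C] [Fintype V] [DecidableEq C] [DecidableEq V]
    {mb : ℕ} (H : Matrix C V (ZMod 2)) (layer : C → Fin mb) (S : Finset V)
    (hS : LETS.IsLETS H S) (hconn : (LETS.inducedSubgraph H S).Connected)
    (hcycle : ¬ LETS.IsSimpleCycle H S) :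
    -- a Frobenius normal form exists; `r` below does not depend on its choice
    (∃ (t : ℕ) (b : LETS.StateVar H S → Fin t),
      LETS.IsFrobeniusNormalForm (LETS.layeredMatrix H layer S) b) ∧
    ∃ r : ℝ,
      -- `r` is a simple eigenvalue, is larger than one, and equals the spectral radius
      1 < r ∧
      (LETS.layeredMatrix H layer S).charpoly.rootMultiplicity r = 1 ∧
      spectralRadius ℂ ((LETS.layeredMatrix H layer S).map (algebraMap ℝ ℂ)) = ENNReal.ofReal r ∧
      -- every Frobenius normal form
      ∀ (t : ℕ) (b : LETS.StateVar H S → Fin t),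
        LETS.IsFrobeniusNormalForm (LETS.layeredMatrix H layer S) b →
        ∃ k : Fin t,
          -- has exactly one irreducible diagonal block
          ((LETS.layeredMatrix H layer S).toSquareBlock b k).IsIrreducible ∧
          (∀ k', ((LETS.layeredMatrix H layer S).toSquareBlock b k').IsIrreducible → k' = k) ∧
          -- which comes last, and the other `n_z` rows and columns give the array `[0 Ã'; 0 Ã]`
          (∀ k', k' ≤ k) ∧
          Nat.card {x // b x ≠ k} = LETS.nz H layer S ∧
          (LETS.layeredMatrix H layer S).toBlock (fun x => b x ≠ k) (fun x => b x ≠ k) = 0 ∧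
          (LETS.layeredMatrix H layer S).toBlock (fun x => b x = k) (fun x => b x ≠ k) = 0 ∧
          -- the left eigenvector for `r`: a positive left eigenvector of `Ã` padded with zeros,
          -- unique up to scaling
          (∃ ω : {x // b x = k} → ℝ, (∀ x, 0 < ω x) ∧
            Matrix.vecMul ω ((LETS.layeredMatrix H layer S).toSquareBlock b k) = r • ω ∧
            (∀ x, 0 ≤ LETS.stack b k 0 ω x) ∧
            Matrix.vecMul (LETS.stack b k 0 ω) (LETS.layeredMatrix H layer S) =
              r • LETS.stack b k 0 ω ∧
            ∀ w : LETS.StateVar H S → ℝ,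
              Matrix.vecMul w (LETS.layeredMatrix H layer S) = r • w →
              ∃ s : ℝ, w = s • LETS.stack b k 0 ω) ∧
          -- the right eigenvector for `r`: a positive right eigenvector `ν` of `Ã` stacked with
          -- `(Ã' / r) ν`, unique up to scaling
          (∃ ν : {x // b x = k} → ℝ, (∀ x, 0 < ν x) ∧
            Matrix.mulVec ((LETS.layeredMatrix H layer S).toSquareBlock b k) ν = r • ν ∧
            (∀ x, 0 ≤ LETS.stack b k (r⁻¹ • Matrix.mulVec ((LETS.layeredMatrix H layer S).toBlock
                  (fun x => b x ≠ k) (fun x => b x = k)) ν) ν x) ∧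
            Matrix.mulVec (LETS.layeredMatrix H layer S)
                (LETS.stack b k (r⁻¹ • Matrix.mulVec ((LETS.layeredMatrix H layer S).toBlock
                  (fun x => b x ≠ k) (fun x => b x = k)) ν) ν) =
              r • LETS.stack b k (r⁻¹ • Matrix.mulVec ((LETS.layeredMatrix H layer S).toBlock
                  (fun x => b x ≠ k) (fun x => b x = k)) ν) ν ∧
            ∀ u : LETS.StateVar H S → ℝ,
              Matrix.mulVec (LETS.layeredMatrix H layer S) u = r • u →
              ∃ s : ℝ, u = s • LETS.stack b k (r⁻¹ • Matrix.mulVec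
                ((LETS.layeredMatrix H layer S).toBlock
                  (fun x => b x ≠ k) (fun x => b x = k)) ν) ν) := by
  have hM := hS.isFinalClass_layeredMatrix hconn hcycle layer
  have hlarge := hS.exists_isCarriedOver_one_lt_sum_layeredMatrix hconn hcycle layer
  have hcard := LETS.card_not_isCarriedOver_floodingMatrix (H := H) (S := S) layer
  refine ⟨hM.exists_isFrobeniusNormalForm, LETS.perronRoot (LETS.layeredMatrix H layer S),
    hM.one_lt_perronRoot (hS.one_le_sum_layeredMatrix layer) hlarge,
    hM.rootMultiplicity_charpoly_perronRoot, hM.spectralRadius_eq_ofReal_perronRoot,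
    fun t b hb => ?_⟩
  obtain ⟨k, hk, hunique, hlast⟩ := hM.exists_block_eq hb
  rw [← hk] at hM hcard
  exact ⟨k, hM.isIrreducible, hunique, hlast, hcard,
    Matrix.ext fun x y => hM.apply_eq_zero x y y.2, Matrix.ext fun x y => hM.apply_eq_zero x y y.2,
    hM.exists_pos_left_eigenvector, hM.exists_pos_right_eigenvector⟩
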